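/- Let $\kappa\in\mathbb R\setminus\{0\}$, $m\in\mathbb R$ and $\eta=\mathrm{diag}(-1,1,1,1,1)$; indices $a,b,c,\dots$ run from $0$ to $4$, $j$ from $1$ to $3$, and repeated indices are summed. **Functions.** Let $\mathcal A$ be the $\kappa$-Minkowski $*$-algebra of ordered series $\sum_{n\in\mathbb N^3}x_1^{n_1}x_2^{n_2}x_3^{n_3}f_n(x_0)$ with entire coefficients $f_n$, where $[x_j,x_0]=\frac i\kappa x_j$, $[x_j,x_k]=0$, $x_\mu^\dagger=x_\mu$. It contains the polynomials in the $x_\mu$ and the plane waves $e^{i\vec k\cdot\vec x}e^{-ik_0x_0}$. The momenta act on ordered series by $P_0=i\partial_{x_0}$, $P_j=-i\partial_{x_j}$; the antipode $S$ is the algebra homomorphism with $S(P_0)=-P_0$, $S(P_j)=-e^{P_0/\kappa}P_j$. **Calculus.** Put $q=\frac1{2\kappa^2}e^{P_0/\kappa}|\vec P|^2$, and $$\lambda=\begin{pmatrix}\cosh\frac{P_0}\kappa+q&\frac1\kappa\vec P&-\sinh\frac{P_0}\kappa-q\\ \frac1\kappa e^{P_0/\kappa}\vec P&I&-\frac1\kappa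 e^{P_0/\kappa}\vec P\\ -\sinh\frac{P_0}\kappa+q&\frac1\kappa\vec P&\cosh\frac{P_0}\kappa-q\end{pmatrix},$$ $$\xi=i\left(-\kappa\sinh\tfrac{P_0}\kappa+\kappa q,\ \vec P,\ \kappa\cosh\tfrac{P_0}\kappa-\kappa q-\kappa\right),\qquad \sigma^a{}_b=S(\lambda^a{}_b),\qquad \chi_a=-S(\xi_a).$$ The algebra of forms $\Gamma^\wedge$ is the free left $\mathcal A$-module on the products $e^{a_1}\wedge\dots\wedge e^{a_n}$, $a_1<\dots<a_n$, of anticommuting one-forms $e^0,\dots,e^4$, with the associative product in which $e^af=(\lambda^a{}_b\triangleright f)e^b$, so that $fe^a=e^b(\sigma^a{}_b\triangleright f)$. The exterior derivative is determined by $df=(\xi_a\triangleright f)e^a=e^a(\chi_a\triangleright f)$, $de^a=0$ and the graded Leibniz rule. Thus $dx_\mu=e^\mu$. The involution on forms is given by $(f\,e^{a_1}\wedge\dots\wedge e^{a_n})^\dagger=(-1)^{n(n-1)/2}e^{a_1}\wedge\dots\wedge e^{a_n}f^\dagger$. The inner derivative $i_a$ is the right $\mathcal A$-linear map that contracts products of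 the $e^b$ in the usual way. Let $\mathrm{vol}=e^0\wedge\dots\wedge e^4$. The Hodge star $*:\Gamma^n\to\Gamma^{5-n}$ is the left $\mathcal A$-linear map with $*1=\mathrm{vol}$, $*e^a=\frac1{4!}\eta^{ab}\epsilon_{bcdef}\,e^c\wedge e^d\wedge e^e\wedge e^f$, $*(e^a\wedge e^b)=\frac1{3!}\eta^{ac}\eta^{bd}\epsilon_{cdefg}\,e^e\wedge e^f\wedge e^g$ ($\epsilon_{01234}=1$), and with $*\circ*=\mathrm{id}$ in all degrees. **Field.** For $\phi\in\mathcal A$ let $\mathscr L=\frac12\{(d\phi)^\dagger\wedge*d\phi+m^2\phi^\dagger\wedge*\phi\}$, the Lagrangian five-form of the action $S=\int\mathscr L$. Let $$j_a=\tfrac12\left\{(\chi_a\triangleright\phi^\dagger)\wedge*d\phi+*d(\sigma^b{}_a\triangleright\phi^\dagger)\wedge(\chi_b\triangleright\phi)\right\}-i_a(\mathscr L),\qquad j=*(\phi^\dagger d\phi-d\phi^\dagger\,\phi).$$ **Statement.** For every $\phi\in\mathcal A$: 1. $\mathscr L=\mathcal L\,\mathrm{vol}$ with $\mathcal L=\frac12\{\eta^{ab}(\xi_a\triangleright\phi^\dagger)(\chi_b\triangleright\phi)+m^2\phi^\dagger\phi\}$;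 2. each $j_a$ is a four-form, and $j_a=*(e^b)\,T_{ab}$ with $$T_{ab}=\tfrac12\left\{(\sigma^c{}_b\chi_a\triangleright\phi^\dagger)(\chi_c\triangleright\phi)+(\sigma^c{}_a\chi_b\triangleright\phi^\dagger)(\chi_c\triangleright\phi)\right\}-\eta_{ab}\mathcal L;$$ 3. $j$ is a four-form; 4. if $\phi$ and $\phi^\dagger$ satisfy the equations of motion $*d*d\,\phi=m^2\phi$ and $*d*d\,\phi^\dagger=m^2\phi^\dagger$, then $dj_a=0$ for all $a$ (conservation of energy and momentum) and $dj=0$ (conservation of the $U(1)$ charge). -/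

import Mathlib

namespace KappaMinkowski

open Complex

/-! ### Entire functions of the time coordinate -/

/-- The algebra of entire functions of one complex variable. -/
def Entire : Subalgebra ℂ (ℂ → ℂ) where
  carrier := {f | Differentiable ℂ f}
  mul_mem' := fun hf hg => Differentiable.mul hf hg
  add_mem' := fun hf hg => Differentiable.add hf hg
  algebraMap_mem' := fun c => differentiable_const c

/-- The translate `t ↦ f (t + c)` of an entire function. -/
noncomputable def shift (c : ℂ) : Entire →ₐ[ℂ] Entire where
  toFun f := ⟨fun t => f.1 (t + c), by
    have hf : Differentiable ℂ f.1 := f.2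
    exact hf.comp (differentiable_id.add_const c)⟩
  map_one' := rfl
  map_mul' _ _ := rfl
  map_zero' := rfl
  map_add' _ _ := rfl
  commutes' _ := rfl

/-- The entire function `t ↦ conj (f (conj t))`. -/
noncomputable def conjEntire (f : Entire) : Entire :=
  ⟨fun t => (starRingEnd ℂ) (f.1 ((starRingEnd ℂ) t)), by
    have hf : Differentiable ℂ f.1 := f.2
    intro t
    have h := (hf ((starRingEnd ℂ) t)).conj_conj
    rw [Complex.conj_conj] at h
    exact h⟩

theorem shift_shift (c c' : ℂ) (f : Entire) : shift c (shift c' f) = shift (c + c') f := by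
  apply Subtype.ext
  funext t
  change f.1 (t + c + c') = f.1 (t + (c + c'))
  rw [add_assoc]

theorem shift_zero (f : Entire) : shift 0 f = f := by
  apply Subtype.ext
  funext t
  change f.1 (t + 0) = f.1 t
  rw [add_zero]

theorem conjEntire_shift (c : ℂ) (f : Entire) :
    conjEntire (shift c f) = shift ((starRingEnd ℂ) c) (conjEntire f) := by
  apply Subtype.ext
  funext t
  change (starRingEnd ℂ) (f.1 ((starRingEnd ℂ) t + c))
    = (starRingEnd ℂ) (f.1 ((starRingEnd ℂ) (t + (starRingEnd ℂ) c)))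
  simp

theorem conjEntire_conjEntire (f : Entire) : conjEntire (conjEntire f) = f := by
  apply Subtype.ext
  funext t
  change (starRingEnd ℂ) ((starRingEnd ℂ) (f.1 ((starRingEnd ℂ) ((starRingEnd ℂ) t)))) = f.1 t
  simp

theorem conjEntire_add (f g : Entire) : conjEntire (f + g) = conjEntire f + conjEntire g := by
  apply Subtype.ext
  funext t
  change (starRingEnd ℂ) (f.1 _ + g.1 _) = _
  rw [map_add]
  rfl

theorem conjEntire_mul (f g : Entire) : conjEntire (f * g) = conjEntire f * conjEntire g := by
  apply Subtype.ext
  funext t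
  change (starRingEnd ℂ) (f.1 _ * g.1 _) = _
  rw [map_mul]
  rfl

/-! ### The algebra of functions on `κ`-Minkowski space -/

/-- Functions on `κ`-Minkowski space, in the ordering that puts time on the right: `f` stands for
the formal series `∑ₙ x₁^{n₁} x₂^{n₂} x₃^{n₃} fₙ(x₀)`, with entire coefficients `fₙ`.  The algebra
contains the coordinates, hence all polynomials in them, and all the plane waves
`e^{i k·x} e^{-i k₀ x₀}`. -/
@[ext]
structure KMink (κ : ℝ) : Type where
  /-- The coefficient functions `fₙ`. -/
  coeff : (Fin 3 →₀ ℕ) → Entire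

/-- A function on `κ`-Minkowski space is the same as its family of coefficient functions. -/
def KMink.equiv (κ : ℝ) : KMink κ ≃ ((Fin 3 →₀ ℕ) → Entire) where
  toFun f := f.coeff
  invFun c := ⟨c⟩

variable {κ : ℝ}

noncomputable instance : AddCommGroup (KMink κ) := (KMink.equiv κ).addCommGroup

noncomputable instance : Module ℂ (KMink κ) := (KMink.equiv κ).module ℂ

/-- The amount `-i |n| / κ` by which time is translated when it is moved through `xⁿ`:
`[x_j, x₀] = (i/κ) x_j` means `f(x₀) xⁿ = xⁿ f(x₀ - i |n| / κ)`. -/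
noncomputable def lag (κ : ℝ) (n : Fin 3 →₀ ℕ) : ℂ := -(I * (n.degree : ℂ) / (κ : ℂ))

theorem lag_add (κ : ℝ) (n p : Fin 3 →₀ ℕ) : lag κ (n + p) = lag κ n + lag κ p := by
  simp only [lag, map_add, Nat.cast_add]
  ring

theorem lag_zero (κ : ℝ) : lag κ 0 = 0 := by
  simp [lag]

theorem conj_lag (κ : ℝ) (n : Fin 3 →₀ ℕ) : (starRingEnd ℂ) (lag κ n) = -lag κ n := by
  simp [lag, neg_div]

/-- `(∑ₚ xᵖ fₚ(x₀)) (∑_q x^q g_q(x₀)) = ∑ₚ,_q x^{p+q} fₚ(x₀ - i |q| / κ) g_q(x₀)`. -/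
noncomputable instance : Mul (KMink κ) :=
  ⟨fun f g => ⟨fun n => ∑ pq ∈ Finset.HasAntidiagonal.antidiagonal n,
    shift (lag κ pq.2) (f.coeff pq.1) * g.coeff pq.2⟩⟩

noncomputable instance : One (KMink κ) := ⟨⟨fun n => if n = 0 then 1 else 0⟩⟩

theorem coeff_mul (f g : KMink κ) (n : Fin 3 →₀ ℕ) :
    (f * g).coeff n = ∑ pq ∈ Finset.HasAntidiagonal.antidiagonal n,
      shift (lag κ pq.2) (f.coeff pq.1) * g.coeff pq.2 := rfl

theorem coeff_one (n : Fin 3 →₀ ℕ) : (1 : KMink κ).coeff n = if n = 0 then 1 else 0 := rfl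

theorem coeff_add (f g : KMink κ) (n : Fin 3 →₀ ℕ) :
    (f + g).coeff n = f.coeff n + g.coeff n := rfl

theorem coeff_zero (n : Fin 3 →₀ ℕ) : (0 : KMink κ).coeff n = 0 := rfl

theorem coeff_smul (c : ℂ) (f : KMink κ) (n : Fin 3 →₀ ℕ) :
    (c • f).coeff n = c • f.coeff n := rfl

noncomputable instance : Ring (KMink κ) where
  mul_assoc f g h := by
    ext1; funext n
    simp only [coeff_mul, Finset.sum_mul, Finset.mul_sum, Finset.sum_sigma', map_sum, map_mul,
      shift_shift]
    refine Finset.sum_nbij' (fun ⟨⟨_i, j⟩, ⟨k, l⟩⟩ ↦ ⟨(k, l + j), (l, j)⟩)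
      (fun ⟨⟨i, _j⟩, ⟨k, l⟩⟩ ↦ ⟨(i + k, l), (i, k)⟩) ?_ ?_ ?_ ?_ ?_
    · rintro ⟨⟨i, j⟩, ⟨k, l⟩⟩ hx
      simp only [Finset.mem_sigma, Finset.HasAntidiagonal.mem_antidiagonal] at hx ⊢
      exact ⟨by rw [← add_assoc, hx.2, hx.1], trivial⟩
    · rintro ⟨⟨i, j⟩, ⟨k, l⟩⟩ hx
      simp only [Finset.mem_sigma, Finset.HasAntidiagonal.mem_antidiagonal] at hx ⊢
      exact ⟨by rw [add_assoc, hx.2, hx.1], trivial⟩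
    · rintro ⟨⟨i, j⟩, ⟨k, l⟩⟩ hx
      simp only [Finset.mem_sigma, Finset.HasAntidiagonal.mem_antidiagonal] at hx
      obtain ⟨-, rfl⟩ := hx
      rfl
    · rintro ⟨⟨i, j⟩, ⟨k, l⟩⟩ hx
      simp only [Finset.mem_sigma, Finset.HasAntidiagonal.mem_antidiagonal] at hx
      obtain ⟨-, rfl⟩ := hx
      rfl
    · rintro ⟨⟨i, j⟩, ⟨k, l⟩⟩ hx
      simp only [lag_add, add_comm (lag κ j), mul_assoc]
  one_mul f := by
    ext1; funext n
    rw [coeff_mul, Finset.sum_eq_single (0, n)]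
    · simp [coeff_one]
    · rintro ⟨p, q⟩ hpq hne
      have hp : p ≠ 0 := by
        rintro rfl
        simp only [Finset.HasAntidiagonal.mem_antidiagonal, zero_add] at hpq
        exact hne (by rw [hpq])
      simp [coeff_one, hp]
    · intro h
      exact absurd (by simp) h
  mul_one f := by
    ext1; funext n
    rw [coeff_mul, Finset.sum_eq_single (n, 0)]
    · simp [coeff_one, lag_zero, shift_zero]
    · rintro ⟨p, q⟩ hpq hne
      have hq : q ≠ 0 := by
        rintro rfl
        simp only [Finset.HasAntidiagonal.mem_antidiagonal, add_zero] at hpq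
        exact hne (by rw [hpq])
      simp [coeff_one, hq]
    · intro h
      exact absurd (by simp) h
  left_distrib f g h := by
    ext1; funext n
    simp only [coeff_mul, coeff_add, mul_add, Finset.sum_add_distrib]
  right_distrib f g h := by
    ext1; funext n
    simp only [coeff_mul, coeff_add, map_add, add_mul, Finset.sum_add_distrib]
  zero_mul f := by
    ext1; funext n
    simp [coeff_mul, coeff_zero]
  mul_zero f := by
    ext1; funext n
    simp [coeff_mul, coeff_zero]
  __ := (inferInstance : AddCommGroup (KMink κ))

noncomputable instance : Algebra ℂ (KMink κ) :=
  Algebra.ofModule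
    (fun c f g => by
      ext1; funext n
      simp only [coeff_mul, coeff_smul, map_smul, smul_mul_assoc, Finset.smul_sum])
    (fun c f g => by
      ext1; funext n
      simp only [coeff_mul, coeff_smul, mul_smul_comm, Finset.smul_sum])

/-- The involution `†`: the antilinear antiautomorphism with `x_μ† = x_μ`, that is
`(xⁿ f(x₀))† = f̄(x₀) xⁿ = xⁿ f̄(x₀ - i |n| / κ)`. -/
noncomputable instance : StarRing (KMink κ) where
  star f := ⟨fun n => shift (lag κ n) (conjEntire (f.coeff n))⟩
  star_involutive f := by
    ext1; funext n
    change shift (lag κ n) (conjEntire (shift (lag κ n) (conjEntire (f.coeff n)))) = f.coeff n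
    rw [conjEntire_shift, shift_shift, conj_lag, conjEntire_conjEntire, add_neg_cancel, shift_zero]
  star_mul f g := by
    ext1; funext n
    have hsum : ∀ (s : Finset ((Fin 3 →₀ ℕ) × (Fin 3 →₀ ℕ)))
        (F : (Fin 3 →₀ ℕ) × (Fin 3 →₀ ℕ) → Entire),
        conjEntire (∑ x ∈ s, F x) = ∑ x ∈ s, conjEntire (F x) := fun s F =>
      map_sum (AddMonoidHom.mk' conjEntire conjEntire_add) F s
    change shift (lag κ n) (conjEntire (∑ pq ∈ Finset.HasAntidiagonal.antidiagonal n,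
        shift (lag κ pq.2) (f.coeff pq.1) * g.coeff pq.2))
      = ∑ pq ∈ Finset.HasAntidiagonal.antidiagonal n, shift (lag κ pq.2)
          (shift (lag κ pq.1) (conjEntire (g.coeff pq.1)))
          * shift (lag κ pq.2) (conjEntire (f.coeff pq.2))
    rw [hsum, map_sum]
    refine Finset.sum_nbij' Prod.swap Prod.swap ?_ ?_ (fun _ _ => rfl) (fun _ _ => rfl) ?_
    · rintro ⟨p, q⟩ hpq
      simpa [add_comm] using hpq
    · rintro ⟨p, q⟩ hpq
      simpa [add_comm] using hpq
    · rintro ⟨p, q⟩ hpq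
      rw [Finset.HasAntidiagonal.mem_antidiagonal] at hpq
      subst hpq
      simp only [Prod.swap, conjEntire_mul, conjEntire_shift, map_mul, shift_shift, conj_lag,
        lag_add]
      rw [mul_comm, add_comm (lag κ p) (lag κ q), add_neg_cancel_comm]
  star_add f g := by
    ext1; funext n
    change shift (lag κ n) (conjEntire (f.coeff n + g.coeff n)) = _
    rw [conjEntire_add, map_add]
    rfl

/-! ### The action of the translation algebra -/

/-- The action of `e^{s P₀/κ}`, where `P₀ = i ∂/∂x₀`: time is translated by `i s / κ`. -/
noncomputable def expP0 (κ : ℝ) (s : ℂ) : Module.End ℂ (KMink κ) where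
  toFun f := ⟨fun n => shift (I * s / (κ : ℂ)) (f.coeff n)⟩
  map_add' f g := by
    ext1; funext n
    exact map_add _ _ _
  map_smul' c f := by
    ext1; funext n
    exact map_smul (shift (I * s / (κ : ℂ))) c (f.coeff n)

/-- The action of the momentum `P_j = -i ∂/∂x_j`. -/
noncomputable def momentum (κ : ℝ) (j : Fin 3) : Module.End ℂ (KMink κ) where
  toFun f := ⟨fun n => (-I * ((n j : ℂ) + 1)) • f.coeff (n + Finsupp.single j 1)⟩
  map_add' f g := by
    ext1; funext n
    exact smul_add _ _ _
  map_smul' c f := by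
    ext1; funext n
    exact smul_comm (-I * ((n j : ℂ) + 1)) c (f.coeff (n + Finsupp.single j 1))

section Expressions

variable {R : Type*} [Ring R] [Algebra ℂ R]

/-- The matrix `λᵃ_b` as an expression in `E = e^{P₀/κ}`, `E' = e^{-P₀/κ}` and the `P_j`. -/
noncomputable def lamExpr (κ : ℝ) (E E' : R) (P : Fin 3 → R) : Matrix (Fin 5) (Fin 5) R :=
  let ch : R := (1 / 2 : ℂ) • (E + E')
  let sh : R := (1 / 2 : ℂ) • (E - E')
  let q : R := (1 / (2 * (κ : ℂ) ^ 2)) • (E * ∑ j, P j * P j)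
  let r : ℂ := 1 / (κ : ℂ)
  !![ch + q,          r • P 0, r • P 1, r • P 2, -sh - q;
     r • (E * P 0),   1,       0,       0,       -(r • (E * P 0));
     r • (E * P 1),   0,       1,       0,       -(r • (E * P 1));
     r • (E * P 2),   0,       0,       1,       -(r • (E * P 2));
     -sh + q,         r • P 0, r • P 1, r • P 2, ch - q]

/-- The components of the exterior derivative, `d f = (ξ_a ▷ f) eᵃ`, as expressions in
`E = e^{P₀/κ}`, `E' = e^{-P₀/κ}` and the `P_j`.  The factor `i` is part of `ξ_a`. -/
noncomputable def xiExpr (κ : ℝ) (E E' : R) (P : Fin 3 → R) : Fin 5 → R :=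
  let ch : R := (1 / 2 : ℂ) • (E + E')
  let sh : R := (1 / 2 : ℂ) • (E - E')
  let q : R := (1 / (2 * (κ : ℂ))) • (E * ∑ j, P j * P j)
  ![I • (-((κ : ℂ) • sh) + q), I • P 0, I • P 1, I • P 2,
    I • ((κ : ℂ) • ch - q - (κ : ℂ) • (1 : R))]

end Expressions

/-- `λᵃ_b`, with `eᵃ f = (λᵃ_b ▷ f) eᵇ`. -/
noncomputable def lam (κ : ℝ) : Matrix (Fin 5) (Fin 5) (Module.End ℂ (KMink κ)) :=
  lamExpr κ (expP0 κ 1) (expP0 κ (-1)) (momentum κ)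

/-- `σᵃ_b = S(λᵃ_b)`, with `f eᵃ = eᵇ (σᵃ_b ▷ f)`.  The antipode is the substitution
`P₀ ↦ -P₀`, `P_j ↦ -e^{P₀/κ} P_j`. -/
noncomputable def sig (κ : ℝ) : Matrix (Fin 5) (Fin 5) (Module.End ℂ (KMink κ)) :=
  lamExpr κ (expP0 κ (-1)) (expP0 κ 1) (fun j => -(expP0 κ 1 * momentum κ j))

/-- `ξ_a`, with `d f = (ξ_a ▷ f) eᵃ`. -/
noncomputable def xi (κ : ℝ) : Fin 5 → Module.End ℂ (KMink κ) :=
  xiExpr κ (expP0 κ 1) (expP0 κ (-1)) (momentum κ)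

/-- `χ_a = -S(ξ_a)`, with `d f = eᵃ (χ_a ▷ f)`. -/
noncomputable def chi (κ : ℝ) (a : Fin 5) : Module.End ℂ (KMink κ) :=
  -xiExpr κ (expP0 κ (-1)) (expP0 κ 1) (fun j => -(expP0 κ 1 * momentum κ j)) a

/-! ### The exterior algebra of the five-dimensional calculus -/

/-- Differential forms: `ω` stands for `∑ ω_A e^A`, where `A = {a₁ < ⋯ < aₙ}` runs over the subsets
of `{0, …, 4}` and `e^A = e^{a₁} ∧ ⋯ ∧ e^{aₙ}`. -/
abbrev Form (κ : ℝ) : Type := Finset (Fin 5) → KMink κ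

/-- The space `Γⁿ` of forms of degree `n`. -/
def Gamma (κ : ℝ) (n : ℕ) : Submodule ℂ (Form κ) where
  carrier := {ω | ∀ A : Finset (Fin 5), A.card ≠ n → ω A = 0}
  add_mem' := fun {ω ρ} hω hρ A hA => by
    change ω A + ρ A = 0
    rw [hω A hA, hρ A hA, add_zero]
  zero_mem' := fun _ _ => rfl
  smul_mem' := fun c ω hω A hA => by
    change c • ω A = 0
    rw [hω A hA, smul_zero]

/-- The basis form `e^A`. -/
noncomputable def basisForm (κ : ℝ) (A : Finset (Fin 5)) : Form κ :=
  fun B => if B = A then 1 else 0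

/-- A function as a `0`-form. -/
noncomputable def ofFun (f : KMink κ) : Form κ := fun B => if B = ∅ then f else 0

/-- The volume form `e⁰ ∧ e¹ ∧ e² ∧ e³ ∧ e⁴`. -/
noncomputable def vol (κ : ℝ) : Form κ := basisForm κ Finset.univ

/-- The sign with `eᵃ ∧ e^{A \ {a}} = sgn a A • e^A` for `a ∈ A`. -/
def sgn (a : Fin 5) (A : Finset (Fin 5)) : ℂ := (-1) ^ (A.filter (· < a)).card

/-- The form `∑_B ∑_b (Mᵃ_b ▷ ω_B) eᵇ ∧ e^B`.  For `M = λ` this is `eᵃ ∧ ω`. -/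
noncomputable def twist (M : Matrix (Fin 5) (Fin 5) (Module.End ℂ (KMink κ))) (a : Fin 5)
    (ω : Form κ) : Form κ :=
  fun A => ∑ b ∈ A, sgn b A • M a b (ω (A.erase b))

/-- For `A = {a₁ < ⋯ < aₙ}`, the composition `twist M a₁ ∘ ⋯ ∘ twist M aₙ`.  For `M = λ` this
is `e^A ∧ ω`. -/
noncomputable def twistList (M : Matrix (Fin 5) (Fin 5) (Module.End ℂ (KMink κ)))
    (A : Finset (Fin 5)) (ω : Form κ) : Form κ :=
  (A.sort (· ≤ ·)).foldr (twist M) ω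

/-- The wedge product, `(∑ ω_A e^A) ∧ ρ = ∑ ω_A (e^A ∧ ρ)`. -/
noncomputable def wedge (ω ρ : Form κ) : Form κ :=
  ∑ A : Finset (Fin 5), ω A • twistList (lam κ) A ρ

/-- The exterior derivative, `d (∑ ω_A e^A) = ∑ (ξ_a ▷ ω_A) eᵃ ∧ e^A`. -/
noncomputable def extD (ω : Form κ) : Form κ :=
  fun A => ∑ a ∈ A, sgn a A • xi κ a (ω (A.erase a))

/-- The right components of `ω = ∑ ω_A e^A`: the coefficients `ω'_A` with `ω = ∑ e^A ω'_A`.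
They are found from `f e^{a₁} ∧ ⋯ ∧ e^{aₙ} = e^{b₁} ∧ ⋯ ∧ e^{bₙ} (σ^{a₁}_{b₁} ⋯ σ^{aₙ}_{bₙ} ▷ f)`. -/
noncomputable def rightCoeff (ω : Form κ) : Finset (Fin 5) → KMink κ :=
  ∑ A : Finset (Fin 5), twistList (sig κ) A (ofFun (ω A))

/-- The form `∑ e^A c_A` with prescribed right components. -/
noncomputable def ofRightCoeff (c : Finset (Fin 5) → KMink κ) : Form κ :=
  ∑ A : Finset (Fin 5), wedge (basisForm κ A) (ofFun (c A))

/-- The inner derivative `i_a`: it is right linear over the functions, and it contracts the basis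
forms in the usual way, `i_a (eᵃ ∧ e^A) = e^A` and `i_a (e^A) = 0` for `a ∉ A`. -/
noncomputable def inner (a : Fin 5) (ω : Form κ) : Form κ :=
  ofRightCoeff fun A => if a ∈ A then 0 else sgn a A • rightCoeff ω (insert a A)

/-- The involution on forms, `(f e^A)† = (-1)^{n(n-1)/2} e^A f†` for `n = |A|`. -/
noncomputable def dagger (ω : Form κ) : Form κ :=
  ofRightCoeff fun A => ((-1 : ℂ) ^ (A.card * (A.card - 1) / 2)) • star (ω A)

/-- The metric `η = diag (-1, 1, 1, 1, 1)`. -/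
def eta (a b : Fin 5) : ℂ := if a = b then (if a = 0 then -1 else 1) else 0

/-- For `A = {a₁ < ⋯ < aₙ}` with complement `{c₁ < ⋯ < c_{5-n}}`, the number
`η_{a₁a₁} ⋯ η_{aₙaₙ} ε_{a₁ ⋯ aₙ c₁ ⋯ c_{5-n}}`. -/
def hodgeSign (A : Finset (Fin 5)) : ℂ :=
  ∏ a ∈ A, eta a a * (-1) ^ (Aᶜ.filter (· < a)).card

/-- The Hodge star.  It is left linear over the functions; on basis forms of degree at most two it
is `* e^A = hodgeSign A • e^{Aᶜ}`, and in the degrees three to five it is the inverse of this, so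
that `* ∘ * = id` in all degrees. -/
noncomputable def hodge (ω : Form κ) : Form κ :=
  fun A => (if A.card ≤ 2 then hodgeSign A else hodgeSign Aᶜ) • ω Aᶜ

/-! ### The complex scalar field -/

/-- The equation of motion `* d * d φ = m² φ`. -/
def EquationOfMotion (m : ℝ) (φ : KMink κ) : Prop :=
  hodge (extD (hodge (extD (ofFun φ)))) = ((m : ℂ) ^ 2) • ofFun φ

/-- The Lagrangian five-form `½ {(dφ)† ∧ * dφ + m² φ† ∧ * φ}`. -/
noncomputable def lagrangian (m : ℝ) (φ : KMink κ) : Form κ :=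
  (1 / 2 : ℂ) • (wedge (dagger (extD (ofFun φ))) (hodge (extD (ofFun φ)))
    + ((m : ℂ) ^ 2) • wedge (dagger (ofFun φ)) (hodge (ofFun φ)))

/-- The function `½ {η^{ab} (ξ_a ▷ φ†) (χ_b ▷ φ) + m² φ† φ}`. -/
noncomputable def density (m : ℝ) (φ : KMink κ) : KMink κ :=
  (1 / 2 : ℂ) • (∑ a, ∑ b, eta a b • (xi κ a (star φ) * chi κ b φ)
    + ((m : ℂ) ^ 2) • (star φ * φ))

/-- The current
`j_a = ½ {(χ_a ▷ φ†) ∧ * dφ + * d(σᵇ_a ▷ φ†) ∧ (χ_b ▷ φ)} - i_a(𝓛)`. -/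
noncomputable def current (m : ℝ) (φ : KMink κ) (a : Fin 5) : Form κ :=
  (1 / 2 : ℂ) • (wedge (ofFun (chi κ a (star φ))) (hodge (extD (ofFun φ)))
    + ∑ b, wedge (hodge (extD (ofFun (sig κ b a (star φ))))) (ofFun (chi κ b φ)))
  - inner a (lagrangian m φ)

/-- The energy–momentum tensor
`T_ab = ½ {(σᶜ_b χ_a ▷ φ†) (χ_c ▷ φ) + (σᶜ_a χ_b ▷ φ†) (χ_c ▷ φ)} - η_ab L`. -/
noncomputable def energyMomentum (m : ℝ) (φ : KMink κ) (a b : Fin 5) : KMink κ :=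
  (1 / 2 : ℂ) • (∑ c, sig κ c b (chi κ a (star φ)) * chi κ c φ
    + ∑ c, sig κ c a (chi κ b (star φ)) * chi κ c φ)
  - eta a b • density m φ

/-- The `U(1)` current `*(φ† dφ - dφ† φ)`. -/
noncomputable def phaseCurrent (φ : KMink κ) : Form κ :=
  hodge (wedge (ofFun (star φ)) (extD (ofFun φ)) - wedge (extD (ofFun (star φ))) (ofFun φ))

end KappaMinkowski

/-!
# Conservation laws for the scalar field on `κ`-Minkowski space

Everything rests on the matrix `λ` of the commutation relations `eᵃ f = (λᵃ_b ▷ f) eᵇ`.  Its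
entries are commuting operators, it is multiplicative, `λᵃ_b ▷ (fg) = (λᵃ_c ▷ f) (λᶜ_b ▷ g)`
(`lam_mul`), and it takes values in `SO(1, 4)`: its inverse `σ` is its adjoint for the metric `η`
(`lam_mul_sig`, `sig_eq_smul_lam`) and its determinant is `1` (`det_lamExpr`).  The exterior
derivative of functions is inner, `d f = iκ (e⁴ f - f e⁴)` (`xi_eq`, `chi_eq`), so the Leibniz rules
for `ξ_a` and `χ_a`, and the relations `χ_b = σᵃ_b ξ_a` and `ξ_b = λᵃ_b χ_a`, are consequences of
these properties of `λ`.

Since `det λ = 1`, the volume form commutes with functions (`twistList_lam_univ`).  As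
`eᵃ ∧ *eᵇ = η^{ab} vol`, it follows that the four-forms `*eᵇ` have the same commutation relations
with functions as the one-forms `eᵇ` (`wedge_coBasis_ofFun`); this replaces the computation of the
four by four minors of `λ`.  The Lagrangian and the currents can then be written with their
coefficients on either side of `vol` and of `*eᵇ` (`lagrangian_eq`, `current_eq`,
`phaseCurrent_eq`), and `d` becomes a divergence:
`d (u_b *eᵇ) = η^{ab} (ξ_a ▷ u_b) vol` and `d (*eᵇ T_b) = η^{ab} (χ_a ▷ T_b) vol`.

What remains is Noether's computation.  The invariance of `η` under `λ` turns
`η^{bc} σᵈ_b χ_c` into `η^{dc} ξ_c`.  With the Leibniz rules, the divergence of the symmetrised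
tensor becomes the sum of the Leibniz expansion of `χ_a ▷ L`, up to terms containing
`η^{ab} ξ_a ξ_b = η^{ab} χ_a χ_b`, which the equations of motion replace by `m²`
(`divergence_energyMomentum`, `divergence_phase`).
-/

namespace KappaMinkowski

open Complex

variable {κ : ℝ}

/-! ### The action of the momenta on products and conjugates -/

theorem coeff_neg (f : KMink κ) (n : Fin 3 →₀ ℕ) : (-f).coeff n = -f.coeff n := rfl

theorem coeff_expP0 (s : ℂ) (f : KMink κ) (n : Fin 3 →₀ ℕ) :
    (expP0 κ s f).coeff n = shift (I * s / (κ : ℂ)) (f.coeff n) := rfl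

theorem coeff_momentum (j : Fin 3) (f : KMink κ) (n : Fin 3 →₀ ℕ) :
    (momentum κ j f).coeff n = (-I * ((n j : ℂ) + 1)) • f.coeff (n + Finsupp.single j 1) := rfl

theorem coeff_star (f : KMink κ) (n : Fin 3 →₀ ℕ) :
    (star f).coeff n = shift (lag κ n) (conjEntire (f.coeff n)) := rfl

theorem lag_single (j : Fin 3) : lag κ (Finsupp.single j 1) = -(I / (κ : ℂ)) := by
  simp [lag]

theorem expP0_mul_expP0 (s t : ℂ) : expP0 κ s * expP0 κ t = expP0 κ (s + t) := by
  refine LinearMap.ext fun f => ?_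
  ext1; funext n
  change shift _ (shift _ _) = shift _ _
  rw [shift_shift]
  congr 2
  ring

theorem expP0_zero : expP0 κ 0 = 1 := by
  refine LinearMap.ext fun f => ?_
  ext1; funext n
  change shift _ _ = f.coeff n
  simp [shift_zero]

theorem commute_expP0_momentum (s : ℂ) (j : Fin 3) :
    Commute (expP0 κ s) (momentum κ j) := by
  refine LinearMap.ext fun f => ?_
  ext1; funext n
  exact map_smul (shift _) _ _

theorem commute_momentum (j k : Fin 3) : Commute (momentum κ j) (momentum κ k) := by
  refine LinearMap.ext fun f => ?_
  ext1; funext n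
  simp only [Module.End.mul_apply, coeff_momentum, smul_smul, Finsupp.add_apply, Nat.cast_add]
  rw [add_right_comm n]
  rcases eq_or_ne j k with rfl | h
  · rfl
  · simp only [Finsupp.single_apply, if_neg h, if_neg h.symm]
    congr 1
    push_cast
    ring

/-- `e^{sP₀/κ}` is group-like: it acts by an automorphism. -/
theorem expP0_mul (s : ℂ) (f g : KMink κ) : expP0 κ s (f * g) = expP0 κ s f * expP0 κ s g := by
  ext1; funext n
  simp only [coeff_expP0, coeff_mul, map_sum, map_mul, shift_shift]
  refine Finset.sum_congr rfl fun x _ => ?_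
  rw [add_comm]

theorem expP0_one (s : ℂ) : expP0 κ s 1 = 1 := by
  ext1; funext n
  simp only [coeff_expP0, coeff_one]
  split_ifs <;> simp

theorem momentum_one (j : Fin 3) : momentum κ j 1 = 0 := by
  ext1; funext n
  have h : n + Finsupp.single j 1 ≠ 0 := fun h => by
    have := DFunLike.congr_fun h j
    simp at this
  simp [coeff_momentum, coeff_one, h, coeff_zero]

/-- The twisted Leibniz rule dual to the coproduct `ΔP_j = P_j ⊗ 1 + e^{-P₀/κ} ⊗ P_j`. -/
theorem momentum_mul (j : Fin 3) (f g : KMink κ) :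
    momentum κ j (f * g) = momentum κ j f * g + expP0 κ (-1) f * momentum κ j g := by
  ext1; funext n
  set e : Fin 3 →₀ ℕ := Finsupp.single j 1 with he
  have hej : e j = 1 := by simp [he]
  have hsub : ∀ p : Fin 3 →₀ ℕ, p j ≠ 0 → p - e + e = p := fun p hp =>
    tsub_add_cancel_of_le (by rw [he, Finsupp.single_le_iff]; omega)
  -- The pairs that are not hit by the reindexing contribute zero because of their weight.
  have h1 : ∑ x ∈ Finset.HasAntidiagonal.antidiagonal n, ((x.1 j : ℂ) + 1) •
        (shift (lag κ x.2) (f.coeff (x.1 + e)) * g.coeff x.2)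
      = ∑ x ∈ Finset.HasAntidiagonal.antidiagonal (n + e), (x.1 j : ℂ) •
        (shift (lag κ x.2) (f.coeff x.1) * g.coeff x.2) := by
    refine Finset.sum_of_injOn (fun x => (x.1 + e, x.2)) ?_ ?_ ?_ ?_
    · rintro ⟨p, q⟩ - ⟨p', q'⟩ - h
      simpa using h
    · rintro ⟨p, q⟩ h
      simp only [Finset.mem_coe, Finset.HasAntidiagonal.mem_antidiagonal] at h ⊢
      rw [← h, add_right_comm]
    · rintro ⟨p, q⟩ h h'
      rcases eq_or_ne (p j) 0 with hp | hp
      · simp [hp]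
      · refine absurd ⟨(p - e, q), ?_, ?_⟩ h'
        · simp only [Finset.mem_coe, Finset.HasAntidiagonal.mem_antidiagonal] at h ⊢
          apply add_right_cancel (b := e)
          rw [add_right_comm, hsub p hp, h]
        · simp [hsub p hp]
    · rintro ⟨p, q⟩ h
      simp [hej]
  have h2 : ∑ x ∈ Finset.HasAntidiagonal.antidiagonal n, ((x.2 j : ℂ) + 1) •
        (shift (lag κ (x.2 + e)) (f.coeff x.1) * g.coeff (x.2 + e))
      = ∑ x ∈ Finset.HasAntidiagonal.antidiagonal (n + e), (x.2 j : ℂ) •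
        (shift (lag κ x.2) (f.coeff x.1) * g.coeff x.2) := by
    refine Finset.sum_of_injOn (fun x => (x.1, x.2 + e)) ?_ ?_ ?_ ?_
    · rintro ⟨p, q⟩ - ⟨p', q'⟩ - h
      simpa using h
    · rintro ⟨p, q⟩ h
      simp only [Finset.mem_coe, Finset.HasAntidiagonal.mem_antidiagonal] at h ⊢
      rw [← h, add_assoc]
    · rintro ⟨p, q⟩ h h'
      rcases eq_or_ne (q j) 0 with hp | hp
      · simp [hp]
      · refine absurd ⟨(p, q - e), ?_, ?_⟩ h'
        · simp only [Finset.mem_coe, Finset.HasAntidiagonal.mem_antidiagonal] at h ⊢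
          apply add_right_cancel (b := e)
          rw [add_assoc, hsub q hp, h]
        · simp [hsub q hp]
    · rintro ⟨p, q⟩ h
      simp [hej]
  -- The exponent that `P_j` brings down from `x^{p+q}` is the sum of those from `xᵖ` and `x^q`.
  have hL : ((-I) • ∑ x ∈ Finset.HasAntidiagonal.antidiagonal (n + e),
      ((x.1 j : ℂ) + (x.2 j : ℂ)) • (shift (lag κ x.2) (f.coeff x.1) * g.coeff x.2))
      = (momentum κ j (f * g)).coeff n := by
    rw [coeff_momentum, coeff_mul, mul_smul]
    congr 1
    rw [Finset.smul_sum]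
    refine Finset.sum_congr rfl fun x hx => ?_
    rw [Finset.HasAntidiagonal.mem_antidiagonal] at hx
    have := DFunLike.congr_fun hx j
    rw [Finsupp.add_apply, Finsupp.add_apply, hej] at this
    congr 1
    exact_mod_cast this
  rw [← hL]
  simp only [add_smul, Finset.sum_add_distrib]
  rw [← h1, ← h2, coeff_add, coeff_mul, coeff_mul, smul_add, Finset.smul_sum, Finset.smul_sum]
  congr 1
  · refine Finset.sum_congr rfl fun x _ => ?_
    rw [coeff_momentum, map_smul, smul_mul_assoc, smul_smul]
  · refine Finset.sum_congr rfl fun x _ => ?_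
    rw [coeff_momentum, coeff_expP0, shift_shift, mul_smul_comm, smul_smul, lag_add, lag_single]
    congr 4
    ring

theorem star_expP0 (s : ℝ) (f : KMink κ) : star (expP0 κ s f) = expP0 κ (-s) (star f) := by
  ext1; funext n
  simp only [coeff_star, coeff_expP0, conjEntire_shift, shift_shift]
  rw [add_comm]
  congr 2
  simp [neg_div]

theorem conjEntire_smul (c : ℂ) (f : Entire) :
    conjEntire (c • f) = (starRingEnd ℂ) c • conjEntire f := by
  apply Subtype.ext
  funext t
  exact map_mul (starRingEnd ℂ) _ _

theorem star_smul_kMink (c : ℂ) (f : KMink κ) : star (c • f) = (starRingEnd ℂ) c • star f := by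
  ext1; funext n
  simp only [coeff_star, coeff_smul, conjEntire_smul, map_smul]

theorem star_momentum (j : Fin 3) (f : KMink κ) :
    star (momentum κ j f) = -expP0 κ 1 (momentum κ j (star f)) := by
  ext1; funext n
  simp only [coeff_neg, coeff_star, coeff_expP0, coeff_momentum, conjEntire_smul, map_smul,
    shift_shift, lag_add, lag_single]
  rw [← neg_smul]
  congr 3
  · simp
  · ring

/-! ### The matrix of commutation relations -/

theorem lamExpr_map {R S : Type*} [Ring R] [Algebra ℂ R] [Ring S] [Algebra ℂ S] (ρ : R →ₐ[ℂ] S)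
    (E E' : R) (P : Fin 3 → R) (a b : Fin 5) :
    ρ (lamExpr κ E E' P a b) = lamExpr κ (ρ E) (ρ E') (fun j => ρ (P j)) a b := by
  fin_cases a <;> fin_cases b <;> simp [lamExpr, Fin.sum_univ_three]

theorem eta_self_mul_self (a : Fin 5) : eta a a * eta a a = 1 := by
  fin_cases a <;> simp [eta]

theorem eta_of_ne {a b : Fin 5} (h : a ≠ b) : eta a b = 0 := by simp [eta, h]

/-- The momenta generate a commutative algebra of operators, so identities between them may be
checked in a commutative ring. -/
theorem exists_commRing_lift (κ : ℝ) :
    ∃ (R : Type) (_ : CommRing R) (_ : Algebra ℂ R) (ρ : R →ₐ[ℂ] Module.End ℂ (KMink κ))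
      (E E' : R) (P : Fin 3 → R), E * E' = 1 ∧ ρ E = expP0 κ 1 ∧ ρ E' = expP0 κ (-1) ∧
        ∀ j, ρ (P j) = momentum κ j := by
  set s : Set (Module.End ℂ (KMink κ)) := {expP0 κ 1, expP0 κ (-1)} ∪ Set.range (momentum κ)
    with hs
  have hEE : Commute (expP0 κ 1) (expP0 κ (-1)) := by
    rw [Commute, SemiconjBy, expP0_mul_expP0, expP0_mul_expP0, add_comm]
  have hcomm : ∀ x ∈ s, ∀ y ∈ s, x * y = y * x := by
    rintro x ((rfl | rfl) | ⟨j, rfl⟩) y ((rfl | rfl) | ⟨k, rfl⟩)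
    · rfl
    · exact hEE
    · exact commute_expP0_momentum _ _
    · exact hEE.symm
    · rfl
    · exact commute_expP0_momentum _ _
    · exact (commute_expP0_momentum _ _).symm
    · exact (commute_expP0_momentum _ _).symm
    · exact commute_momentum _ _
  have hadj := Algebra.isMulCommutative_adjoin ℂ hcomm
  let _ : CommRing (Algebra.adjoin ℂ s) :=
    { (inferInstance : Ring (Algebra.adjoin ℂ s)) with mul_comm := hadj.is_comm.comm }
  refine ⟨Algebra.adjoin ℂ s, inferInstance, inferInstance, (Algebra.adjoin ℂ s).val,
    ⟨expP0 κ 1, Algebra.subset_adjoin (by simp [hs])⟩,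
    ⟨expP0 κ (-1), Algebra.subset_adjoin (by simp [hs])⟩,
    fun j => ⟨momentum κ j, Algebra.subset_adjoin (by simp [hs])⟩, ?_, rfl, rfl, fun _ => rfl⟩
  apply Subtype.ext
  change expP0 κ 1 * expP0 κ (-1) = 1
  rw [expP0_mul_expP0, add_neg_cancel, expP0_zero]

/-- The antipode of `λ` is the inverse of `λ`. -/
theorem lamExpr_mul_antipode {R : Type*} [CommRing R] [Algebra ℂ R] {E E' : R} (h : E * E' = 1)
    (P : Fin 3 → R) :
    lamExpr κ E E' P * lamExpr κ E' E (fun j => -(E * P j)) = 1 := by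
  have h2 : (2 : R) * algebraMap ℂ R (1 / 2) = 1 := by
    rw [← map_ofNat (algebraMap ℂ R) 2, ← map_mul]
    norm_num
  have h3 : algebraMap ℂ R (1 / (2 * (κ : ℂ) ^ 2))
      = algebraMap ℂ R (1 / 2) * algebraMap ℂ R (1 / (κ : ℂ)) ^ 2 := by
    rw [← map_pow, ← map_mul]
    congr 1
    ring
  ext a b
  -- Each entry is an identity of polynomials in `E`, `E'`, `P_j`, `1 / κ` and `1 / 2`.
  fin_cases a <;> fin_cases b <;>
    simp [lamExpr, Matrix.mul_apply, Fin.sum_univ_five, Fin.sum_univ_three, Algebra.smul_def,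
      -one_div, h3, -map_div₀, -map_inv₀] <;>
    generalize algebraMap ℂ R (1 / (κ : ℂ)) = k at * <;>
    generalize algebraMap ℂ R (1 / 2) = c at * <;>
    grind

/-- The antipode of `λ` is also its adjoint for the metric: `λ` takes values in `SO(1, 4)`. -/
theorem lamExpr_antipode_eq {R : Type*} [CommRing R] [Algebra ℂ R] {E E' : R} (h : E * E' = 1)
    (P : Fin 3 → R) (a b : Fin 5) :
    lamExpr κ E' E (fun j => -(E * P j)) a b = (eta a a * eta b b) • lamExpr κ E E' P b a := by
  have hE : E' * E = 1 := by rw [mul_comm, h]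
  have h1 : ∀ x : R, E' * (E * x) = x := fun x => by rw [← mul_assoc, hE, one_mul]
  have h2 : ∀ x y : R, E' * (E * x * (E * y)) = E * (x * y) := fun x y => by
    linear_combination (E * x * y) * hE
  fin_cases a <;> fin_cases b <;>
    simp [lamExpr, Fin.sum_univ_three, eta, mul_add, h1, h2] <;> module

theorem det_lamExpr {R : Type*} [CommRing R] [Algebra ℂ R] {E E' : R} (h : E * E' = 1)
    (P : Fin 3 → R) : (lamExpr κ E E' P).det = 1 := by
  have h2 : (2 : R) * algebraMap ℂ R (1 / 2) = 1 := by
    rw [← map_ofNat (algebraMap ℂ R) 2, ← map_mul]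
    norm_num
  have h3 : algebraMap ℂ R (1 / (2 * (κ : ℂ) ^ 2))
      = algebraMap ℂ R (1 / 2) * algebraMap ℂ R (1 / (κ : ℂ)) ^ 2 := by
    rw [← map_pow, ← map_mul]
    congr 1
    ring
  simp [lamExpr, Matrix.det_succ_row_zero, Fin.sum_univ_succ, Fin.succAbove, Algebra.smul_def,
      -one_div, h3, -map_div₀, -map_inv₀]
  generalize algebraMap ℂ R (1 / (κ : ℂ)) = k at *
  generalize algebraMap ℂ R (1 / 2) = c at *
  grind

/-- Both `λ` and `σ` are images of matrices over one commutative ring. -/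
theorem exists_commRing_matrix (κ : ℝ) :
    ∃ (R : Type) (_ : CommRing R) (_ : Algebra ℂ R) (ρ : R →ₐ[ℂ] Module.End ℂ (KMink κ))
      (M N : Matrix (Fin 5) (Fin 5) R), lam κ = M.map ρ ∧ sig κ = N.map ρ ∧ M * N = 1 ∧
        (∀ a b, N a b = (eta a a * eta b b) • M b a) ∧ M.det = 1 ∧ N.det = 1 := by
  obtain ⟨R, _, _, ρ, E, E', P, h, hE, hE', hP⟩ := exists_commRing_lift κ
  refine ⟨R, inferInstance, inferInstance, ρ, lamExpr κ E E' P,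
    lamExpr κ E' E (fun j => -(E * P j)), ?_, ?_, lamExpr_mul_antipode h P,
    lamExpr_antipode_eq h P, det_lamExpr h P, det_lamExpr (by rw [mul_comm, h]) _⟩
  · ext1 a b
    rw [Matrix.map_apply, lamExpr_map, hE, hE', funext hP, lam]
  · ext1 a b
    rw [Matrix.map_apply, lamExpr_map, hE, hE', sig]
    simp only [map_neg, map_mul, hE, hP]

theorem commute_lam (a b c d : Fin 5) : Commute (lam κ a b) (lam κ c d) := by
  obtain ⟨R, _, _, ρ, M, N, hM, hN, -⟩ := exists_commRing_matrix κ
  rw [hM]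
  exact (Commute.all (M a b) (M c d)).map ρ

theorem sig_eq_smul_lam (a b : Fin 5) :
    sig κ a b = (eta a a * eta b b) • lam κ b a := by
  obtain ⟨R, _, _, ρ, M, N, hM, hN, -, h, -⟩ := exists_commRing_matrix κ
  rw [hM, hN, Matrix.map_apply, h, map_smul, Matrix.map_apply]

theorem lam_mul_sig : lam κ * sig κ = 1 := by
  obtain ⟨R, _, _, ρ, M, N, hM, hN, h, -⟩ := exists_commRing_matrix κ
  rw [hM, hN]
  have := congrArg ρ.mapMatrix h
  simpa using this

theorem sig_mul_lam : sig κ * lam κ = 1 := by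
  obtain ⟨R, _, _, ρ, M, N, hM, hN, h, -⟩ := exists_commRing_matrix κ
  rw [hM, hN]
  have := congrArg ρ.mapMatrix (mul_eq_one_comm.mp h)
  simpa using this

theorem commute_lam_sig (a b c d : Fin 5) : Commute (lam κ a b) (sig κ c d) := by
  rw [sig_eq_smul_lam]
  exact (commute_lam _ _ _ _).smul_right _

theorem commute_sig (a b c d : Fin 5) : Commute (sig κ a b) (sig κ c d) := by
  rw [sig_eq_smul_lam a b]
  exact (commute_lam_sig _ _ _ _).smul_left _

set_option maxHeartbeats 2000000 in
/-- The coproduct of `λ` is that of a matrix: `Δλᵃ_b = λᵃ_c ⊗ λᶜ_b`. -/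
theorem lam_mul (a b : Fin 5) (f g : KMink κ) :
    lam κ a b (f * g) = ∑ c, lam κ a c f * lam κ c b g := by
  have hE : ∀ f : KMink κ, expP0 κ 1 (expP0 κ (-1) f) = f := fun f => by
    rw [← Module.End.mul_apply, expP0_mul_expP0, add_neg_cancel, expP0_zero, Module.End.one_apply]
  have hP : ∀ j (f : KMink κ),
      momentum κ j (expP0 κ (-1) f) = expP0 κ (-1) (momentum κ j f) := fun j f =>
    (LinearMap.congr_fun (commute_expP0_momentum (-1) j) f).symm
  fin_cases a <;> fin_cases b <;>
    simp [lam, lamExpr, Fin.sum_univ_five, Fin.sum_univ_three, expP0_mul, momentum_mul, hE, hP,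
      mul_add, add_mul, mul_sub, sub_mul, smul_smul, smul_add, smul_sub] <;>
    match_scalars <;> ring

theorem lam_one (a b : Fin 5) : lam κ a b 1 = if a = b then 1 else 0 := by
  fin_cases a <;> fin_cases b <;>
    simp [lam, lamExpr, Fin.sum_univ_three, expP0_one, momentum_one] <;>
    match_scalars <;> norm_num

theorem sig_mul (a b : Fin 5) (f g : KMink κ) :
    sig κ a b (f * g) = ∑ c, sig κ c b f * sig κ a c g := by
  simp only [sig_eq_smul_lam, LinearMap.smul_apply, lam_mul, Finset.smul_sum, smul_mul_smul_comm]
  refine Finset.sum_congr rfl fun c _ => ?_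
  congr 1
  linear_combination (-eta a a * eta b b) * eta_self_mul_self c

/-- The exterior derivative is inner, `d f = iκ (e⁴ f - f e⁴)`. -/
theorem xi_eq (hκ : κ ≠ 0) (a : Fin 5) :
    xi κ a = (I * κ) • (lam κ 4 a - if a = 4 then 1 else 0) := by
  have hκ' : (κ : ℂ) ≠ 0 := by exact_mod_cast hκ
  fin_cases a <;> simp [xi, xiExpr, lam, lamExpr, smul_smul, smul_sub, smul_add] <;>
    match_scalars <;> field_simp <;> norm_num

theorem chi_eq (hκ : κ ≠ 0) (a : Fin 5) :
    chi κ a = (I * κ) • ((if a = 4 then 1 else 0) - sig κ 4 a) := by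
  have hκ' : (κ : ℂ) ≠ 0 := by exact_mod_cast hκ
  fin_cases a <;> simp [chi, xiExpr, sig, lamExpr, smul_smul, smul_sub, smul_add] <;>
    match_scalars <;> field_simp <;> norm_num

/-! ### Exterior multiplication -/

theorem sgn_erase_self (a : Fin 5) (A : Finset (Fin 5)) : sgn a (A.erase a) = sgn a A := by
  unfold sgn
  congr 2
  ext c
  simp only [Finset.mem_filter, Finset.mem_erase]
  constructor
  · rintro ⟨⟨-, h⟩, h'⟩
    exact ⟨h, h'⟩
  · rintro ⟨h, h'⟩
    exact ⟨⟨h'.ne, h⟩, h'⟩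

theorem sgn_mul_self (a : Fin 5) (A : Finset (Fin 5)) : sgn a A * sgn a A = 1 := by
  rw [sgn, ← pow_add, Even.neg_one_pow ⟨_, rfl⟩]

theorem sgn_erase_of_lt {c d : Fin 5} {A : Finset (Fin 5)} (hc : c ∈ A) (h : c < d) :
    sgn d (A.erase c) = -sgn d A := by
  have hA : A.filter (· < d) = insert c ((A.erase c).filter (· < d)) := by
    ext x
    simp only [Finset.mem_filter, Finset.mem_insert, Finset.mem_erase]
    constructor
    · rintro ⟨hx, hxd⟩
      by_cases hxc : x = c
      · exact Or.inl hxc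
      · exact Or.inr ⟨⟨hxc, hx⟩, hxd⟩
    · rintro (rfl | ⟨⟨-, hx⟩, hxd⟩)
      · exact ⟨hc, h⟩
      · exact ⟨hx, hxd⟩
  rw [sgn, sgn, hA, Finset.card_insert_of_notMem (by simp), pow_succ]
  ring

theorem sgn_erase_of_gt {c d : Fin 5} {A : Finset (Fin 5)} (h : d < c) :
    sgn d (A.erase c) = sgn d A := by
  unfold sgn
  congr 2
  ext x
  simp only [Finset.mem_filter, Finset.mem_erase]
  constructor
  · rintro ⟨⟨-, hx⟩, hx'⟩
    exact ⟨hx, hx'⟩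
  · rintro ⟨hx, hx'⟩
    exact ⟨⟨(hx'.trans h).ne, hx⟩, hx'⟩

theorem sgn_mul_sgn_erase {c d : Fin 5} {A : Finset (Fin 5)} (hc : c ∈ A) (hd : d ∈ A)
    (h : c ≠ d) : sgn c A * sgn d (A.erase c) = -(sgn d A * sgn c (A.erase d)) := by
  rcases lt_or_gt_of_ne h with h | h
  · rw [sgn_erase_of_lt hc h, sgn_erase_of_gt h]
    ring
  · rw [sgn_erase_of_gt h, sgn_erase_of_lt hd h]
    ring

section Twist

variable {M : Matrix (Fin 5) (Fin 5) (Module.End ℂ (KMink κ))}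

theorem twist_apply (a : Fin 5) (ω : Form κ) (A : Finset (Fin 5)) :
    twist M a ω A = ∑ b ∈ A, sgn b A • M a b (ω (A.erase b)) := rfl

theorem twist_add (a : Fin 5) (ω ρ : Form κ) :
    twist M a (ω + ρ) = twist M a ω + twist M a ρ := by
  funext A
  simp only [twist_apply, Pi.add_apply, map_add, smul_add, Finset.sum_add_distrib]

theorem twist_zero (a : Fin 5) : twist M a (0 : Form κ) = 0 := by
  funext A
  simp [twist_apply]

theorem twist_neg (a : Fin 5) (ω : Form κ) : twist M a (-ω) = -twist M a ω := by
  rw [eq_neg_iff_add_eq_zero, ← twist_add, neg_add_cancel, twist_zero]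

theorem twist_sum {ι : Type*} (s : Finset ι) (a : Fin 5) (ω : ι → Form κ) :
    twist M a (∑ i ∈ s, ω i) = ∑ i ∈ s, twist M a (ω i) :=
  map_sum (⟨⟨twist M a, twist_zero a⟩, twist_add a⟩ : Form κ →+ Form κ) ω s

theorem twist_mem_Gamma {n : ℕ} (a : Fin 5) {ω : Form κ} (h : ω ∈ Gamma κ n) :
    twist M a ω ∈ Gamma κ (n + 1) := by
  intro A hA
  refine Finset.sum_eq_zero fun b hb => ?_
  rw [h (A.erase b), map_zero, smul_zero]
  have := Finset.card_erase_add_one hb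
  omega

theorem foldr_twist_mem_Gamma (l : List (Fin 5)) {n : ℕ} {ω : Form κ} (h : ω ∈ Gamma κ n) :
    l.foldr (twist M) ω ∈ Gamma κ (n + l.length) := by
  induction l with
  | nil => exact h
  | cons a l ih => exact twist_mem_Gamma a ih

theorem ofFun_mem_Gamma (f : KMink κ) : ofFun f ∈ Gamma κ 0 := by
  intro A hA
  rw [ofFun, if_neg]
  rintro rfl
  exact hA rfl

theorem twistList_ofFun_mem_Gamma (A : Finset (Fin 5)) (f : KMink κ) :
    twistList M A (ofFun f) ∈ Gamma κ A.card := by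
  have h := foldr_twist_mem_Gamma (M := M) (A.sort (· ≤ ·)) (ofFun_mem_Gamma f)
  rwa [zero_add, Finset.length_sort] at h

theorem twistList_zero (A : Finset (Fin 5)) : twistList M A (0 : Form κ) = 0 := by
  unfold twistList
  induction A.sort (· ≤ ·) with
  | nil => rfl
  | cons a l ih => rw [List.foldr_cons, ih, twist_zero]

theorem ofFun_zero : ofFun (0 : KMink κ) = 0 := by
  funext A
  simp [ofFun]

/-- The `eᵃ` anticommute, because the entries of the matrix commute. -/
theorem twist_twist (hM : ∀ a b c d, Commute (M a b) (M c d)) (a b : Fin 5) (ω : Form κ) :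
    twist M a (twist M b ω) = -twist M b (twist M a ω) := by
  have key : ∀ (a b : Fin 5) (A : Finset (Fin 5)), twist M a (twist M b ω) A
      = ∑ c ∈ A, ∑ d ∈ A, if c = d then 0 else
        (sgn c A * sgn d (A.erase c)) • M a c (M b d (ω ((A.erase c).erase d))) := by
    intro a b A
    refine Finset.sum_congr rfl fun c hc => ?_
    rw [twist_apply, map_sum, Finset.smul_sum]
    refine Eq.trans ?_ (Finset.sum_subset (Finset.erase_subset c A) ?_)
    · refine Finset.sum_congr rfl fun d hd => ?_
      rw [if_neg (Finset.ne_of_mem_erase hd).symm, map_smul, smul_smul]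
    · intro d hd hd'
      rw [if_pos]
      by_contra h
      exact hd' (Finset.mem_erase.2 ⟨Ne.symm h, hd⟩)
  funext A
  rw [Pi.neg_apply, key, key, Finset.sum_comm, ← Finset.sum_neg_distrib]
  refine Finset.sum_congr rfl fun d hd => ?_
  rw [← Finset.sum_neg_distrib]
  refine Finset.sum_congr rfl fun c hc => ?_
  rcases eq_or_ne c d with rfl | h
  · simp
  · rw [if_neg h, if_neg h.symm, sgn_mul_sgn_erase hc hd h, neg_smul, Finset.erase_right_comm]
    congr 2
    exact LinearMap.congr_fun (hM a c b d) _

theorem twist_twist_self (hM : ∀ a b c d, Commute (M a b) (M c d)) (a : Fin 5) (ω : Form κ) :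
    twist M a (twist M a ω) = 0 := by
  have h : (2 : ℂ) • twist M a (twist M a ω) = 0 := by
    rw [two_smul]
    exact eq_neg_iff_add_eq_zero.1 (twist_twist hM a a ω)
  rw [← one_smul ℂ (twist M a (twist M a ω)), ← inv_mul_cancel₀ (two_ne_zero (α := ℂ)), mul_smul,
    h, smul_zero]

theorem sort_eq_of_pairwise {A : Finset (Fin 5)} {l : List (Fin 5)}
    (h : l.Nodup ∧ l.Pairwise (· ≤ ·) ∧ A = l.toFinset) : A.sort (· ≤ ·) = l := by
  rw [h.2.2]
  exact (List.toFinset_sort (· ≤ ·) h.1).2 h.2.1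

theorem twistList_univ (ω : Form κ) : twistList M Finset.univ ω
    = twist M 0 (twist M 1 (twist M 2 (twist M 3 (twist M 4 ω)))) := by
  have h : (Finset.univ : Finset (Fin 5)).sort (· ≤ ·) = [0, 1, 2, 3, 4] :=
    sort_eq_of_pairwise (by decide)
  rw [twistList, h]
  rfl

/-- `eᵃ ∧ e^{univ \ {b}} = ± δᵃ_b e^{univ}`. -/
theorem twist_twistList_compl (hM : ∀ a b c d, Commute (M a b) (M c d)) (a b : Fin 5)
    (ω : Form κ) : twist M a (twistList M (Finset.univ.erase b) ω)
      = if a = b then sgn b Finset.univ • twistList M Finset.univ ω else 0 := by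
  have h0 : (Finset.univ.erase (0 : Fin 5)).sort (· ≤ ·) = [1, 2, 3, 4] :=
    sort_eq_of_pairwise (by decide)
  have h1 : (Finset.univ.erase (1 : Fin 5)).sort (· ≤ ·) = [0, 2, 3, 4] :=
    sort_eq_of_pairwise (by decide)
  have h2 : (Finset.univ.erase (2 : Fin 5)).sort (· ≤ ·) = [0, 1, 3, 4] :=
    sort_eq_of_pairwise (by decide)
  have h3 : (Finset.univ.erase (3 : Fin 5)).sort (· ≤ ·) = [0, 1, 2, 4] :=
    sort_eq_of_pairwise (by decide)
  have h4 : (Finset.univ.erase (4 : Fin 5)).sort (· ≤ ·) = [0, 1, 2, 3] :=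
    sort_eq_of_pairwise (by decide)
  have s0 : sgn 0 Finset.univ = 1 := by simp [sgn]
  have s1 : sgn 1 Finset.univ = -1 := by
    rw [sgn, show (Finset.univ.filter (· < (1 : Fin 5))).card = 1 by decide]; norm_num
  have s2 : sgn 2 Finset.univ = 1 := by
    rw [sgn, show (Finset.univ.filter (· < (2 : Fin 5))).card = 2 by decide]; norm_num
  have s3 : sgn 3 Finset.univ = -1 := by
    rw [sgn, show (Finset.univ.filter (· < (3 : Fin 5))).card = 3 by decide]; norm_num
  have s4 : sgn 4 Finset.univ = 1 := by
    rw [sgn, show (Finset.univ.filter (· < (4 : Fin 5))).card = 4 by decide]; norm_num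
  have hswap : ∀ (a b : Fin 5) (_ : b < a) (ω : Form κ),
      twist M a (twist M b ω) = -twist M b (twist M a ω) := fun a b _ => twist_twist hM a b
  rw [twistList_univ]
  fin_cases a <;> fin_cases b <;>
    simp [twistList, h0, h1, h2, h3, h4, s0, s1, s2, s3, s4, hswap, twist_twist_self hM,
      twist_neg, twist_zero]

end Twist

/-! ### The volume form is central -/

/-- Exterior multiplication by the one-form with components `v`, over any commutative ring. -/
def wedgeLeft {R : Type*} [CommRing R] (v : Fin 5 → R) (c : Finset (Fin 5) → R) :
    Finset (Fin 5) → R :=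
  fun A => ∑ b ∈ A, (-1) ^ (A.filter (· < b)).card * (v b * c (A.erase b))

theorem wedgeLeft_apply {R : Type*} [CommRing R] (v : Fin 5 → R) (c : Finset (Fin 5) → R)
    (A : Finset (Fin 5)) : wedgeLeft v c A =
      ∑ b, if b ∈ A then (∏ i, if i ∈ A ∧ i < b then -1 else 1) * (v b * c (A.erase b)) else 0 := by
  rw [wedgeLeft, ← Finset.sum_filter, Finset.filter_univ_mem]
  refine Finset.sum_congr rfl fun b _ => ?_
  rw [Finset.prod_ite]
  simp [Finset.filter_and, Finset.inter_filter]

set_option maxHeartbeats 4000000 in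
/-- The determinant is the top coefficient of the product of the rows. -/
theorem wedgeLeft_det {R : Type*} [CommRing R] (M : Matrix (Fin 5) (Fin 5) R) :
    wedgeLeft (M 0) (wedgeLeft (M 1) (wedgeLeft (M 2) (wedgeLeft (M 3) (wedgeLeft (M 4)
      (fun B => if B = ∅ then 1 else 0))))) Finset.univ = M.det := by
  have h : ∀ B : Finset (Fin 5), B = ∅ ↔ 0 ∉ B ∧ 1 ∉ B ∧ 2 ∉ B ∧ 3 ∉ B ∧ 4 ∉ B := by decide
  -- Both sides are expanded into the sum over the 120 permutations.
  simp [wedgeLeft_apply, Fin.prod_univ_five, h, Matrix.det_succ_row_zero,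
    Fin.sum_univ_succ, Fin.succAbove]
  ring

theorem twist_map {R : Type*} [CommRing R] [Algebra ℂ R] (ρ : R →ₐ[ℂ] Module.End ℂ (KMink κ))
    (M : Matrix (Fin 5) (Fin 5) R) (a : Fin 5) (c : Finset (Fin 5) → R) (f : KMink κ) :
    twist (M.map ρ) a (fun A => ρ (c A) f) = fun A => ρ (wedgeLeft (M a) c A) f := by
  funext A
  rw [twist_apply, wedgeLeft, map_sum, LinearMap.sum_apply]
  refine Finset.sum_congr rfl fun b _ => ?_
  rw [Matrix.map_apply, ← Module.End.mul_apply, ← map_mul, ← LinearMap.smul_apply, ← map_smul]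
  congr 2
  rw [sgn, Algebra.smul_def]
  simp

theorem smul_vol_apply (f : KMink κ) (A : Finset (Fin 5)) :
    (f • vol κ) A = if A = Finset.univ then f else 0 := by
  simp [vol, basisForm]

theorem twistList_univ_ofFun {R : Type*} [CommRing R] [Algebra ℂ R]
    (ρ : R →ₐ[ℂ] Module.End ℂ (KMink κ)) {M : Matrix (Fin 5) (Fin 5) R} (hM : M.det = 1)
    (f : KMink κ) : twistList (M.map ρ) Finset.univ (ofFun f) = f • vol κ := by
  funext A
  rw [smul_vol_apply]
  split_ifs with hA
  · have h0 : ofFun f = fun A => ρ (if A = ∅ then 1 else 0) f := by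
      funext A
      rw [ofFun]
      split_ifs <;> simp
    rw [hA, twistList_univ, h0]
    simp only [twist_map, wedgeLeft_det, hM, map_one, Module.End.one_apply]
  · refine twistList_ofFun_mem_Gamma _ f A fun h => hA ?_
    exact Finset.card_eq_iff_eq_univ A |>.1 (by simpa using h)

theorem twistList_lam_univ (f : KMink κ) :
    twistList (lam κ) Finset.univ (ofFun f) = f • vol κ := by
  obtain ⟨R, _, _, ρ, M, N, hM, -, -, -, h, -⟩ := exists_commRing_matrix κ
  rw [hM, twistList_univ_ofFun ρ h]

theorem twistList_sig_univ (f : KMink κ) :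
    twistList (sig κ) Finset.univ (ofFun f) = f • vol κ := by
  obtain ⟨R, _, _, ρ, M, N, -, hN, -, -, -, h⟩ := exists_commRing_matrix κ
  rw [hN, twistList_univ_ofFun ρ h]

/-! ### The components of the exterior derivative -/

theorem sum_lam_sig_apply (a c : Fin 5) (f : KMink κ) :
    ∑ b, lam κ a b (sig κ b c f) = if a = c then f else 0 := by
  have h := congrFun (congrFun (lam_mul_sig (κ := κ)) a) c
  rw [Matrix.mul_apply, Matrix.one_apply] at h
  have h' := LinearMap.congr_fun h f
  rw [LinearMap.sum_apply] at h'
  simp only [Module.End.mul_apply] at h'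
  rw [h']
  split_ifs <;> rfl

theorem sum_sig_lam_apply (a c : Fin 5) (f : KMink κ) :
    ∑ b, sig κ a b (lam κ b c f) = if a = c then f else 0 := by
  have h := congrFun (congrFun (sig_mul_lam (κ := κ)) a) c
  rw [Matrix.mul_apply, Matrix.one_apply] at h
  have h' := LinearMap.congr_fun h f
  rw [LinearMap.sum_apply] at h'
  simp only [Module.End.mul_apply] at h'
  rw [h']
  split_ifs <;> rfl

theorem sig_lam_comm (a b c d : Fin 5) (f : KMink κ) :
    sig κ a b (lam κ c d f) = lam κ c d (sig κ a b f) :=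
  (LinearMap.congr_fun (commute_lam_sig c d a b) f).symm

theorem xi_apply (hκ : κ ≠ 0) (a : Fin 5) (f : KMink κ) :
    xi κ a f = (I * κ) • (lam κ 4 a f - if a = 4 then f else 0) := by
  rw [xi_eq hκ]
  split_ifs <;> simp

theorem chi_apply (hκ : κ ≠ 0) (a : Fin 5) (f : KMink κ) :
    chi κ a f = (I * κ) • ((if a = 4 then f else 0) - sig κ 4 a f) := by
  rw [chi_eq hκ]
  split_ifs <;> simp

/-- The left Leibniz rule, `d(fg) = f dg + df g`. -/
theorem xi_mul (hκ : κ ≠ 0) (b : Fin 5) (f g : KMink κ) :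
    xi κ b (f * g) = f * xi κ b g + ∑ a, xi κ a f * lam κ a b g := by
  simp only [xi_apply hκ, lam_mul, smul_mul_assoc, mul_smul_comm, ← Finset.smul_sum, ← smul_add,
    sub_mul, mul_sub, Finset.sum_sub_distrib, ite_mul, zero_mul, mul_ite, mul_zero,
    Finset.sum_ite_eq', Finset.mem_univ, if_true]
  congr 1
  abel

/-- The right Leibniz rule, `d(fg) = df g + f dg`. -/
theorem chi_mul (hκ : κ ≠ 0) (b : Fin 5) (f g : KMink κ) :
    chi κ b (f * g) = chi κ b f * g + ∑ a, sig κ a b f * chi κ a g := by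
  simp only [chi_apply hκ, sig_mul, smul_mul_assoc, mul_smul_comm, ← Finset.smul_sum, ← smul_add,
    sub_mul, mul_sub, Finset.sum_sub_distrib, ite_mul, zero_mul, mul_ite, mul_zero,
    Finset.sum_ite_eq', Finset.mem_univ, if_true]
  congr 1
  abel

theorem sum_sig_xi (hκ : κ ≠ 0) (b : Fin 5) (f : KMink κ) :
    ∑ a, sig κ a b (xi κ a f) = chi κ b f := by
  have h (a : Fin 5) : sig κ a b (xi κ a f)
      = (I * κ) • (lam κ 4 a (sig κ a b f) - if a = 4 then sig κ a b f else 0) := by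
    rw [xi_apply hκ, map_smul, map_sub, sig_lam_comm, apply_ite (sig κ a b), map_zero]
  simp only [h, ← Finset.smul_sum, Finset.sum_sub_distrib, sum_lam_sig_apply, chi_apply hκ,
    Finset.sum_ite_eq', Finset.mem_univ, if_true, eq_comm]

theorem sum_lam_chi (hκ : κ ≠ 0) (b : Fin 5) (f : KMink κ) :
    ∑ a, lam κ a b (chi κ a f) = xi κ b f := by
  have h (a : Fin 5) : lam κ a b (chi κ a f)
      = (I * κ) • ((if a = 4 then lam κ a b f else 0) - sig κ 4 a (lam κ a b f)) := by
    rw [chi_apply hκ, map_smul, map_sub, sig_lam_comm, apply_ite (lam κ a b), map_zero]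
  simp only [h, ← Finset.smul_sum, Finset.sum_sub_distrib, sum_sig_lam_apply, xi_apply hκ,
    Finset.sum_ite_eq', Finset.mem_univ, if_true, eq_comm]

theorem commute_sig_xi (hκ : κ ≠ 0) (a b c : Fin 5) : Commute (sig κ a b) (xi κ c) := by
  rw [xi_eq hκ]
  refine ((commute_lam_sig 4 c a b).symm.sub_right ?_).smul_right _
  split_ifs
  exacts [Commute.one_right _, Commute.zero_right _]

theorem commute_sig_chi (hκ : κ ≠ 0) (a b c : Fin 5) : Commute (sig κ a b) (chi κ c) := by
  rw [chi_eq hκ]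
  refine (Commute.sub_right ?_ (commute_sig a b 4 c)).smul_right _
  split_ifs
  exacts [Commute.one_right _, Commute.zero_right _]

theorem commute_chi_xi (hκ : κ ≠ 0) (a c : Fin 5) : Commute (chi κ a) (xi κ c) := by
  rw [chi_eq hκ]
  refine (Commute.sub_left ?_ (commute_sig_xi hκ 4 a c)).smul_left _
  split_ifs
  exacts [Commute.one_left _, Commute.zero_left _]

theorem commute_chi_chi (hκ : κ ≠ 0) (a c : Fin 5) : Commute (chi κ a) (chi κ c) := by
  rw [chi_eq hκ a]
  refine (Commute.sub_left ?_ (commute_sig_chi hκ 4 a c)).smul_left _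
  split_ifs
  exacts [Commute.one_left _, Commute.zero_left _]

theorem commute_lam_xi (hκ : κ ≠ 0) (a b c : Fin 5) : Commute (lam κ a b) (xi κ c) := by
  rw [xi_eq hκ]
  refine ((commute_lam a b 4 c).sub_right ?_).smul_right _
  split_ifs
  exacts [Commute.one_right _, Commute.zero_right _]

theorem eta_smul_sig (a b : Fin 5) (f : KMink κ) :
    eta b b • sig κ a b f = eta a a • lam κ b a f := by
  rw [sig_eq_smul_lam, LinearMap.smul_apply, smul_smul]
  congr 1
  linear_combination eta a a * eta_self_mul_self b

theorem sum_eta_smul_lam_xi (hκ : κ ≠ 0) (a : Fin 5) (f : KMink κ) :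
    ∑ b, eta b b • lam κ a b (xi κ b f) = eta a a • chi κ a f := by
  simp only [← eta_smul_sig, ← Finset.smul_sum, sum_sig_xi hκ]

theorem sum_eta_smul_sig_chi (hκ : κ ≠ 0) (a : Fin 5) (f : KMink κ) :
    ∑ b, eta b b • sig κ a b (chi κ b f) = eta a a • xi κ a f := by
  simp only [eta_smul_sig, ← Finset.smul_sum, sum_lam_chi hκ]

theorem star_lam_four (a : Fin 5) (f : KMink κ) :
    star (lam κ 4 a f) = sig κ 4 a (star f) := by
  have hE : ∀ f : KMink κ, star (expP0 κ 1 f) = expP0 κ (-1) (star f) := fun f => by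
    simpa using star_expP0 1 f
  have hE' : ∀ f : KMink κ, star (expP0 κ (-1) f) = expP0 κ 1 (star f) := fun f => by
    simpa using star_expP0 (-1) f
  have hc : ∀ (j : Fin 3) (f : KMink κ),
      momentum κ j (expP0 κ 1 f) = expP0 κ 1 (momentum κ j f) := fun j f =>
    (LinearMap.congr_fun (commute_expP0_momentum 1 j) f).symm
  have h2 : (starRingEnd ℂ) 2 = 2 := map_ofNat _ 2
  fin_cases a <;>
    simp [lam, sig, lamExpr, Fin.sum_univ_three, star_smul_kMink, star_momentum, hE, hE', hc, h2]

theorem star_xi (hκ : κ ≠ 0) (a : Fin 5) (f : KMink κ) : star (xi κ a f) = chi κ a (star f) := by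
  rw [xi_apply hκ, chi_apply hκ, star_smul_kMink, star_sub, star_lam_four, apply_ite star,
    star_zero, map_mul, conj_I, conj_ofReal, neg_mul, neg_smul, ← smul_neg, neg_sub]

/-- The d'Alembertian `η^{ab} ξ_a ξ_b`. -/
noncomputable def box (f : KMink κ) : KMink κ := ∑ a, eta a a • xi κ a (xi κ a f)

theorem sum_eta_smul_chi_chi (hκ : κ ≠ 0) (f : KMink κ) :
    ∑ a, eta a a • chi κ a (chi κ a f) = box f := by
  have h : ∀ a, eta a a • chi κ a (chi κ a f)
      = ∑ b, eta a a • sig κ b a (chi κ a (xi κ b f)) := fun a => by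
    rw [← sum_sig_xi hκ a f, map_sum, Finset.smul_sum]
    refine Finset.sum_congr rfl fun b _ => ?_
    congr 1
    exact (LinearMap.congr_fun (commute_sig_chi hκ b a a) _).symm
  simp only [h]
  rw [Finset.sum_comm]
  simp only [sum_eta_smul_sig_chi hκ]
  rfl

/-! ### Divergences -/

/-- The divergence `η^{bc} χ_c ▷ (σᵈ_b u) (χ_d φ)`. -/
theorem divergence_sig_mul_chi (hκ : κ ≠ 0) (u φ : KMink κ) :
    ∑ b, eta b b • chi κ b (∑ c, sig κ c b u * chi κ c φ)
      = ∑ c, eta c c • (xi κ c u * chi κ c φ) + u * box φ := by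
  have h1 : ∀ c, ∑ b, eta b b • (chi κ b (sig κ c b u) * chi κ c φ)
      = eta c c • (xi κ c u * chi κ c φ) := fun c => by
    simp only [← smul_mul_assoc, ← Finset.sum_mul]
    rw [← sum_eta_smul_sig_chi hκ]
    congr 1
    refine Finset.sum_congr rfl fun b _ => ?_
    congr 1
    exact (LinearMap.congr_fun (commute_sig_chi hκ c b b) _).symm
  have h2 : ∀ d c, ∑ b, eta b b • (sig κ d b (sig κ c b u) * chi κ d (chi κ c φ))
      = if c = d then eta d d • (u * chi κ d (chi κ d φ)) else 0 := fun d c => by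
    have h : ∀ b, eta b b • sig κ d b (sig κ c b u) = eta d d • lam κ b d (sig κ c b u) :=
      fun b => eta_smul_sig _ _ _
    simp only [← smul_mul_assoc, ← Finset.sum_mul, h, ← sig_lam_comm, ← Finset.smul_sum,
      sum_sig_lam_apply]
    split_ifs with hcd
    · rw [hcd]
    · simp
  simp only [map_sum, chi_mul hκ, Finset.smul_sum, smul_add, Finset.sum_add_distrib]
  congr 1
  · rw [Finset.sum_comm]
    exact Finset.sum_congr rfl fun c _ => h1 c
  · rw [Finset.sum_comm]
    have h3 : ∀ c, ∑ b, ∑ d, eta b b • (sig κ d b (sig κ c b u) * chi κ d (chi κ c φ))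
        = eta c c • (u * chi κ c (chi κ c φ)) := fun c => by
      rw [Finset.sum_comm]
      simp only [h2, Finset.sum_ite_eq, Finset.mem_univ, if_true]
    rw [Finset.sum_congr rfl fun c _ => h3 c]
    simp only [← mul_smul_comm, ← Finset.mul_sum, sum_eta_smul_chi_chi hκ]

/-- The divergence `η^{bc} χ_c ▷ (σᵈ_a χ_b ψ) (χ_d φ)`. -/
theorem divergence_sig_chi_mul_chi (hκ : κ ≠ 0) (a : Fin 5) (ψ φ : KMink κ) :
    ∑ b, eta b b • chi κ b (∑ c, sig κ c a (chi κ b ψ) * chi κ c φ)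
      = ∑ c, sig κ c a (box ψ) * chi κ c φ
        + ∑ b, ∑ c, eta b b • (sig κ c a (xi κ b ψ) * chi κ c (chi κ b φ)) := by
  simp only [map_sum, chi_mul hκ, Finset.smul_sum, smul_add, Finset.sum_add_distrib]
  congr 1
  · rw [Finset.sum_comm]
    refine Finset.sum_congr rfl fun c _ => ?_
    rw [← sum_eta_smul_chi_chi hκ, map_sum, Finset.sum_mul]
    refine Finset.sum_congr rfl fun b _ => ?_
    rw [map_smul, smul_mul_assoc]
    congr 2
    exact (LinearMap.congr_fun (commute_sig_chi hκ c a b) _).symm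
  · have h : ∀ c d, ∑ b, eta b b • (sig κ d b (sig κ c a (chi κ b ψ)) * chi κ d (chi κ c φ))
        = eta d d • (sig κ c a (xi κ d ψ) * chi κ c (chi κ d φ)) := fun c d => by
      have h1 : ∀ b, sig κ d b (sig κ c a (chi κ b ψ)) = sig κ c a (sig κ d b (chi κ b ψ)) :=
        fun b => LinearMap.congr_fun (commute_sig d b c a) _
      have h2 : chi κ d (chi κ c φ) = chi κ c (chi κ d φ) :=
        LinearMap.congr_fun (commute_chi_chi hκ d c) _
      have h3 : ∑ b, eta b b • sig κ c a (sig κ d b (chi κ b ψ))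
          = eta d d • sig κ c a (xi κ d ψ) := by
        rw [← map_smul, ← sum_eta_smul_sig_chi hκ, map_sum]
        simp only [map_smul]
      simp only [← smul_mul_assoc, ← Finset.sum_mul, h1, h2, h3]
    rw [Finset.sum_comm, Finset.sum_comm (s := Finset.univ) (t := Finset.univ)
      (f := fun b c => eta b b • (sig κ c a (xi κ b ψ) * chi κ c (chi κ b φ)))]
    refine Finset.sum_congr rfl fun c _ => ?_
    rw [Finset.sum_comm]
    exact Finset.sum_congr rfl fun d _ => h c d

theorem density_eq (m : ℝ) (φ : KMink κ) :
    density m φ = (1 / 2 : ℂ) • (∑ a, eta a a • (xi κ a (star φ) * chi κ a φ)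
      + ((m : ℂ) ^ 2) • (star φ * φ)) := by
  rw [density]
  congr 2
  refine Finset.sum_congr rfl fun a _ => Finset.sum_eq_single a (fun b _ h => ?_) (by simp)
  rw [eta_of_ne h.symm, zero_smul]

theorem chi_density (hκ : κ ≠ 0) (m : ℝ) (φ : KMink κ) (a : Fin 5) :
    chi κ a (density m φ) = (1 / 2 : ℂ) • (∑ c, eta c c • (xi κ c (chi κ a (star φ)) * chi κ c φ)
      + ∑ b, ∑ c, eta b b • (sig κ c a (xi κ b (star φ)) * chi κ c (chi κ b φ))
      + (((m : ℂ) ^ 2) • (chi κ a (star φ) * φ)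
      + ((m : ℂ) ^ 2) • ∑ c, sig κ c a (star φ) * chi κ c φ)) := by
  have h : ∀ c f, chi κ a (xi κ c f) = xi κ c (chi κ a f) := fun c f =>
    LinearMap.congr_fun (commute_chi_xi hκ a c) f
  rw [density_eq]
  simp only [map_smul, map_add, map_sum, chi_mul hκ, smul_add, Finset.sum_add_distrib,
    Finset.smul_sum, h]

/-- On shell, the energy–momentum tensor is conserved. -/
theorem divergence_energyMomentum (hκ : κ ≠ 0) (m : ℝ) (φ : KMink κ)
    (h1 : box φ = ((m : ℂ) ^ 2) • φ) (h2 : box (star φ) = ((m : ℂ) ^ 2) • star φ) (a : Fin 5) :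
    ∑ b, eta b b • chi κ b (energyMomentum m φ a b) = 0 := by
  have h3 : ∑ b, eta b b • chi κ b (eta a b • density m φ) = chi κ a (density m φ) := by
    rw [Finset.sum_eq_single a (fun b _ h => ?_) (by simp)]
    · rw [map_smul, smul_smul, eta_self_mul_self, one_smul]
    · rw [eta_of_ne h.symm, zero_smul, map_zero, smul_zero]
  have h4 : ∀ b, eta b b • chi κ b (energyMomentum m φ a b)
      = (1 / 2 : ℂ) • (eta b b • chi κ b (∑ c, sig κ c b (chi κ a (star φ)) * chi κ c φ)
        + eta b b • chi κ b (∑ c, sig κ c a (chi κ b (star φ)) * chi κ c φ))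
        - eta b b • chi κ b (eta a b • density m φ) := fun b => by
    rw [energyMomentum, map_sub, map_smul, map_add, smul_sub, ← smul_add, smul_comm]
  rw [Finset.sum_congr rfl fun b _ => h4 b, Finset.sum_sub_distrib, h3, ← Finset.smul_sum,
    Finset.sum_add_distrib, divergence_sig_mul_chi hκ, divergence_sig_chi_mul_chi hκ,
    chi_density hκ, h1, h2, ← smul_sub]
  simp only [map_smul, smul_mul_assoc, mul_smul_comm, ← Finset.smul_sum]
  rw [smul_eq_zero_of_right]
  abel

/-- On shell, the components of the `U(1)` current are divergence-free. -/
theorem divergence_phase (hκ : κ ≠ 0) (c : ℂ) (ψ φ : KMink κ)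
    (h1 : box φ = c • φ) (h2 : box ψ = c • ψ) :
    ∑ a, eta a a • xi κ a (ψ * xi κ a φ - ∑ b, xi κ b ψ * lam κ b a φ) = 0 := by
  have h3 : ∑ a, eta a a • xi κ a (ψ * xi κ a φ)
      = ψ * box φ + ∑ b, eta b b • (xi κ b ψ * chi κ b φ) := by
    simp only [xi_mul hκ, smul_add, Finset.sum_add_distrib, ← mul_smul_comm, ← Finset.mul_sum]
    congr 1
    simp only [Finset.smul_sum]
    rw [Finset.sum_comm]
    simp only [← mul_smul_comm, ← Finset.mul_sum, sum_eta_smul_lam_xi hκ]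
  have h5 : ∀ b d, ∑ a, eta a a • (xi κ d (xi κ b ψ) * lam κ d a (lam κ b a φ))
      = if b = d then eta b b • (xi κ b (xi κ b ψ) * φ) else 0 := fun b d => by
    have h : ∀ a, eta a a • lam κ d a (lam κ b a φ) = eta b b • lam κ d a (sig κ a b φ) :=
      fun a => by rw [← map_smul, ← eta_smul_sig, map_smul]
    simp only [← mul_smul_comm, ← Finset.mul_sum, h, ← Finset.smul_sum, sum_lam_sig_apply]
    rcases eq_or_ne b d with rfl | hbd
    · simp
    · simp [hbd, hbd.symm]
  have h4 : ∑ a, eta a a • xi κ a (∑ b, xi κ b ψ * lam κ b a φ)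
      = ∑ b, eta b b • (xi κ b ψ * chi κ b φ) + box ψ * φ := by
    simp only [map_sum, xi_mul hκ, smul_add, Finset.sum_add_distrib, Finset.smul_sum]
    congr 1
    · rw [Finset.sum_comm]
      refine Finset.sum_congr rfl fun b _ => ?_
      rw [← mul_smul_comm (eta b b), ← sum_eta_smul_lam_xi hκ, Finset.mul_sum]
      refine Finset.sum_congr rfl fun a _ => ?_
      rw [mul_smul_comm]
      congr 2
      exact (LinearMap.congr_fun (commute_lam_xi hκ b a a) _).symm
    · rw [Finset.sum_comm, box, Finset.sum_mul]
      refine Finset.sum_congr rfl fun b _ => ?_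
      rw [Finset.sum_comm, Finset.sum_congr rfl fun d _ => h5 b d]
      simp
  simp only [map_sub, smul_sub, Finset.sum_sub_distrib]
  rw [h3, h4, h1, h2, smul_mul_assoc, mul_smul_comm]
  abel

/-! ### Forms of degree one and four -/

theorem form_smul_apply (f : KMink κ) (ω : Form κ) (A : Finset (Fin 5)) :
    (f • ω) A = f * ω A := rfl

theorem complex_smul_smul (c : ℂ) (f : KMink κ) (ω : Form κ) : c • f • ω = (c • f) • ω := by
  funext A
  change c • (f * ω A) = (c • f) * ω A
  rw [smul_mul_assoc]

theorem smul_complex_smul (c : ℂ) (f : KMink κ) (ω : Form κ) : f • c • ω = (c • f) • ω := by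
  funext A
  change f * (c • ω A) = (c • f) * ω A
  rw [mul_smul_comm, smul_mul_assoc]

theorem basisForm_apply (A B : Finset (Fin 5)) :
    basisForm κ A B = if B = A then 1 else 0 := rfl

theorem ofFun_eq_smul (f : KMink κ) : ofFun f = f • basisForm κ ∅ := by
  funext A
  simp [ofFun, basisForm]

theorem smul_mem_Gamma {n : ℕ} (f : KMink κ) {ω : Form κ} (h : ω ∈ Gamma κ n) :
    f • ω ∈ Gamma κ n := by
  intro A hA
  rw [form_smul_apply, h A hA, mul_zero]

theorem basisForm_mem_Gamma (A : Finset (Fin 5)) : basisForm κ A ∈ Gamma κ A.card := by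
  intro B hB
  rw [basisForm_apply, if_neg]
  rintro rfl
  exact hB rfl

theorem wedge_add_left (ω ω' ρ : Form κ) : wedge (ω + ω') ρ = wedge ω ρ + wedge ω' ρ := by
  simp only [wedge, Pi.add_apply, add_smul, Finset.sum_add_distrib]

theorem wedge_zero_left (ρ : Form κ) : wedge 0 ρ = 0 := by simp [wedge]

theorem wedge_sum_left {ι : Type*} (s : Finset ι) (ω : ι → Form κ) (ρ : Form κ) :
    wedge (∑ i ∈ s, ω i) ρ = ∑ i ∈ s, wedge (ω i) ρ :=
  map_sum (⟨⟨fun ω => wedge ω ρ, wedge_zero_left ρ⟩, fun ω ω' => wedge_add_left ω ω' ρ⟩ :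
    Form κ →+ Form κ) ω s

theorem wedge_smul_left (f : KMink κ) (ω ρ : Form κ) : wedge (f • ω) ρ = f • wedge ω ρ := by
  simp only [wedge, form_smul_apply, mul_smul, Finset.smul_sum]

theorem wedge_smul_complex_left (c : ℂ) (ω ρ : Form κ) : wedge (c • ω) ρ = c • wedge ω ρ := by
  simp only [wedge, Pi.smul_apply, ← complex_smul_smul, Finset.smul_sum]

theorem wedge_basisForm (A : Finset (Fin 5)) (ρ : Form κ) :
    wedge (basisForm κ A) ρ = twistList (lam κ) A ρ := by
  simp [wedge, basisForm_apply]

theorem wedge_basisForm_singleton (a : Fin 5) (ρ : Form κ) :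
    wedge (basisForm κ {a}) ρ = twist (lam κ) a ρ := by
  rw [wedge_basisForm, twistList, sort_eq_of_pairwise (l := [a]) (by simp)]
  rfl

theorem wedge_ofFun (f : KMink κ) (ρ : Form κ) : wedge (ofFun f) ρ = f • ρ := by
  rw [ofFun_eq_smul, wedge_smul_left, wedge_basisForm, twistList,
    sort_eq_of_pairwise (l := []) (by simp)]
  rfl

theorem twist_smul (a : Fin 5) (f : KMink κ) (ω : Form κ) :
    twist (lam κ) a (f • ω) = ∑ c, lam κ a c f • twist (lam κ) c ω := by
  funext A
  simp only [twist_apply, form_smul_apply, lam_mul, Finset.sum_apply, Finset.mul_sum,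
    Finset.smul_sum, mul_smul_comm]
  rw [Finset.sum_comm]

theorem hodge_add (ω ρ : Form κ) : hodge (ω + ρ) = hodge ω + hodge ρ := by
  funext A
  exact smul_add _ _ _

theorem hodge_zero : hodge (0 : Form κ) = 0 := by
  funext A
  exact smul_zero _

theorem hodge_smul (f : KMink κ) (ω : Form κ) : hodge (f • ω) = f • hodge ω := by
  funext A
  exact (mul_smul_comm _ _ _).symm

theorem hodge_sum {ι : Type*} (s : Finset ι) (ω : ι → Form κ) :
    hodge (∑ i ∈ s, ω i) = ∑ i ∈ s, hodge (ω i) :=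
  map_sum (⟨⟨hodge, hodge_zero⟩, hodge_add⟩ : Form κ →+ Form κ) ω s

theorem hodgeSign_empty : hodgeSign ∅ = 1 := Finset.prod_empty

theorem hodge_ofFun (f : KMink κ) : hodge (ofFun f) = f • vol κ := by
  funext A
  rw [smul_vol_apply]
  change _ • ofFun f Aᶜ = _
  by_cases hA : A = Finset.univ
  · subst hA
    rw [if_neg (by decide), if_pos rfl, Finset.compl_univ, hodgeSign_empty, one_smul]
    rfl
  · have h : ofFun f Aᶜ = 0 := if_neg (by rwa [Finset.compl_eq_empty_iff])
    rw [if_neg hA, h, smul_zero]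

theorem hodge_vol_empty : hodge (vol κ) ∅ = 1 := by
  change _ • vol κ ∅ᶜ = _
  rw [if_pos (by simp), hodgeSign_empty, one_smul, Finset.compl_empty]
  rw [vol, basisForm_apply, if_pos rfl]

/-- The four-form `*(eᵇ)`. -/
noncomputable def coBasis (κ : ℝ) (b : Fin 5) : Form κ := hodge (basisForm κ {b})

theorem coBasis_eq (b : Fin 5) :
    coBasis κ b = (eta b b * sgn b Finset.univ) • basisForm κ (Finset.univ.erase b) := by
  funext A
  have hA : Aᶜ = {b} ↔ A = Finset.univ.erase b := by
    rw [compl_eq_comm, Finset.compl_singleton, eq_comm]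
  rw [coBasis, hodge, basisForm_apply, Pi.smul_apply, basisForm_apply]
  by_cases h : A = Finset.univ.erase b
  · rw [if_pos (hA.2 h), if_pos h, hA.2 h, if_neg (by rw [h]; simp)]
    congr 1
    rw [hodgeSign, Finset.prod_singleton, Finset.compl_singleton]
    congr 1
    exact sgn_erase_self b Finset.univ
  · rw [if_neg (mt hA.1 h), if_neg h, smul_zero, smul_zero]

theorem coBasis_mem_Gamma (b : Fin 5) : coBasis κ b ∈ Gamma κ 4 := by
  rw [coBasis_eq]
  refine Submodule.smul_mem _ _ ?_
  simpa using basisForm_mem_Gamma (κ := κ) (Finset.univ.erase b)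

theorem card_eq_four {A : Finset (Fin 5)} (h : A.card = 4) : ∃ b, A = Finset.univ.erase b := by
  have : Aᶜ.card = 1 := by rw [Finset.card_compl, h]; rfl
  obtain ⟨b, hb⟩ := Finset.card_eq_one.1 this
  exact ⟨b, by rw [← Finset.compl_singleton, ← hb, compl_compl]⟩

theorem eq_of_mem_Gamma_four {ω ρ : Form κ} (hω : ω ∈ Gamma κ 4) (hρ : ρ ∈ Gamma κ 4)
    (h : ∀ b, ω (Finset.univ.erase b) = ρ (Finset.univ.erase b)) : ω = ρ := by
  funext A
  by_cases hA : A.card = 4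
  · obtain ⟨b, rfl⟩ := card_eq_four hA
    exact h b
  · rw [hω A hA, hρ A hA]

theorem sum_smul_coBasis_mem_Gamma (u : Fin 5 → KMink κ) :
    ∑ b, u b • coBasis κ b ∈ Gamma κ 4 :=
  Submodule.sum_mem _ fun b _ => smul_mem_Gamma _ (coBasis_mem_Gamma b)

theorem sum_smul_coBasis_apply (u : Fin 5 → KMink κ) (a : Fin 5) :
    (∑ b, u b • coBasis κ b) (Finset.univ.erase a) = (eta a a * sgn a Finset.univ) • u a := by
  rw [Finset.sum_apply, Finset.sum_eq_single a]
  · rw [form_smul_apply, coBasis_eq, Pi.smul_apply, basisForm_apply, if_pos rfl, mul_smul_comm,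
      mul_one]
  · intro b _ hb
    rw [form_smul_apply, coBasis_eq, Pi.smul_apply, basisForm_apply, if_neg, smul_zero, mul_zero]
    intro h
    have : b ∈ Finset.univ.erase a := by simp [hb]
    rw [h] at this
    simp at this
  · simp

/-- `eᵃ ∧ *eᵇ = η^{ab} vol`. -/
theorem twist_coBasis (a b : Fin 5) :
    twist (lam κ) a (coBasis κ b) = if a = b then eta b b • vol κ else 0 := by
  funext A
  by_cases hA : A = Finset.univ
  · subst hA
    have h : ∀ c, coBasis κ b (Finset.univ.erase c)
        = if c = b then (eta b b * sgn b Finset.univ) • (1 : KMink κ) else 0 := fun c => by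
      rw [coBasis_eq, Pi.smul_apply, basisForm_apply]
      by_cases hc : c = b
      · rw [hc, if_pos rfl, if_pos rfl]
      · rw [if_neg hc, if_neg, smul_zero]
        intro h
        have : b ∈ Finset.univ.erase c := by simp [Ne.symm hc]
        rw [h] at this
        simp at this
    rw [twist_apply, Finset.sum_eq_single b
      (fun c _ hc => by rw [h, if_neg hc, map_zero, smul_zero]) (by simp), h, if_pos rfl,
      map_smul, lam_one, smul_smul, mul_left_comm, sgn_mul_self, mul_one]
    split_ifs
    · rw [Pi.smul_apply, vol, basisForm_apply, if_pos rfl]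
    · exact smul_zero _
  · rw [twist_mem_Gamma a (coBasis_mem_Gamma b) A fun h => hA (Finset.card_eq_iff_eq_univ A |>.1 h)]
    split_ifs
    · rw [Pi.smul_apply, vol, basisForm_apply, if_neg hA, smul_zero]
    · rfl

/-- `d (u_b *eᵇ) = η^{ab} (ξ_a ▷ u_b) vol`. -/
theorem extD_sum_smul_coBasis (u : Fin 5 → KMink κ) :
    extD (∑ b, u b • coBasis κ b) = (∑ b, eta b b • xi κ b (u b)) • vol κ := by
  funext A
  rw [smul_vol_apply, extD]
  split_ifs with hA
  · subst hA
    refine Finset.sum_congr rfl fun a _ => ?_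
    rw [sum_smul_coBasis_apply, map_smul, smul_smul, mul_left_comm, sgn_mul_self, mul_one]
  · refine Finset.sum_eq_zero fun a ha => ?_
    rw [sum_smul_coBasis_mem_Gamma u, map_zero, smul_zero]
    intro h
    apply hA
    rw [← Finset.card_eq_iff_eq_univ]
    rw [← Finset.card_erase_add_one ha, h]
    rfl

theorem eq_singleton_iff_erase {A : Finset (Fin 5)} {a : Fin 5} :
    A = {a} ↔ a ∈ A ∧ A.erase a = ∅ := by
  constructor
  · rintro rfl
    simp
  · rintro ⟨ha, h⟩
    rw [← Finset.insert_erase ha, h]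
    rfl

theorem sgn_singleton (a : Fin 5) : sgn a {a} = 1 := by
  simp [sgn, Finset.filter_singleton]

theorem extD_ofFun (f : KMink κ) : extD (ofFun f) = ∑ a, xi κ a f • basisForm κ {a} := by
  funext A
  rw [extD, Finset.sum_apply, ← Finset.sum_subset (Finset.subset_univ A)]
  · refine Finset.sum_congr rfl fun a ha => ?_
    rw [form_smul_apply, basisForm_apply, ofFun]
    by_cases hA : A = {a}
    · rw [if_pos hA, if_pos (eq_singleton_iff_erase.1 hA).2, hA, sgn_singleton, mul_one, one_smul]
    · rw [if_neg hA, if_neg fun h' => hA (eq_singleton_iff_erase.2 ⟨ha, h'⟩),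
        map_zero, smul_zero, mul_zero]
  · intro a _ ha
    rw [form_smul_apply, basisForm_apply, if_neg fun h' => ha (eq_singleton_iff_erase.1 h').1,
      mul_zero]

theorem hodge_extD_ofFun (f : KMink κ) : hodge (extD (ofFun f)) = ∑ a, xi κ a f • coBasis κ a := by
  rw [extD_ofFun, hodge_sum]
  simp only [hodge_smul, coBasis]

/-- The four-forms `*eᵇ` commute with functions as the `eᵇ` do. -/
theorem wedge_coBasis_ofFun (b : Fin 5) (f : KMink κ) :
    wedge (coBasis κ b) (ofFun f) = ∑ c, lam κ b c f • coBasis κ c := by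
  have h1 : wedge (coBasis κ b) (ofFun f) = (eta b b * sgn b Finset.univ) •
      twistList (lam κ) (Finset.univ.erase b) (ofFun f) := by
    rw [coBasis_eq, wedge_smul_complex_left, wedge_basisForm]
  set ω := twistList (lam κ) (Finset.univ.erase b) (ofFun f) with hω
  have hmem : ω ∈ Gamma κ 4 := by
    simpa using twistList_ofFun_mem_Gamma (M := lam κ) (Finset.univ.erase b) f
  -- The components of `ω` are read off from the products `eᵃ ∧ ω`, which are multiples of the
  -- central form `vol`.
  -- The matrix `λ` in the resulting linear equations is inverted by `σ`.
  have h2 : ∀ a, ∑ c, lam κ a c (sgn c Finset.univ • ω (Finset.univ.erase c))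
      = if a = b then sgn b Finset.univ • f else 0 := fun a => by
    have h := congrFun (twist_twistList_compl (commute_lam (κ := κ)) a b (ofFun f)) Finset.univ
    rw [twist_apply] at h
    simp only [map_smul]
    rw [hω, h]
    split_ifs
    · rw [Pi.smul_apply, twistList_lam_univ, smul_vol_apply, if_pos rfl]
    · rfl
  have h3 : ∀ c, sgn c Finset.univ • ω (Finset.univ.erase c)
      = sig κ c b (sgn b Finset.univ • f) := fun c => by
    have h4 : ∑ a, sig κ c a (∑ d, lam κ a d (sgn d Finset.univ • ω (Finset.univ.erase d)))
        = sgn c Finset.univ • ω (Finset.univ.erase c) := by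
      simp only [map_sum]
      rw [Finset.sum_comm]
      simp only [sum_sig_lam_apply, Finset.sum_ite_eq, Finset.mem_univ, if_true]
    rw [← h4]
    simp only [h2]
    rw [Finset.sum_eq_single b (fun a _ h => by rw [if_neg h, map_zero]) (by simp), if_pos rfl]
  rw [h1]
  refine eq_of_mem_Gamma_four (Submodule.smul_mem _ _ hmem) (sum_smul_coBasis_mem_Gamma _)
    fun c => ?_
  have h5 : ω (Finset.univ.erase c)
      = (sgn c Finset.univ * sgn b Finset.univ * (eta c c * eta b b)) • lam κ b c f := by
    rw [← one_smul ℂ (ω _), ← sgn_mul_self c Finset.univ, mul_smul, h3, map_smul,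
      sig_eq_smul_lam, LinearMap.smul_apply, smul_smul, smul_smul]
  rw [sum_smul_coBasis_apply, Pi.smul_apply, h5, smul_smul]
  congr 1
  linear_combination (sgn b Finset.univ * sgn b Finset.univ * sgn c Finset.univ * eta c c) *
    eta_self_mul_self b + sgn c Finset.univ * eta c c * sgn_mul_self b Finset.univ

/-! ### The Lagrangian -/

theorem twist_ofFun (a : Fin 5) (f : KMink κ) :
    twist (lam κ) a (ofFun f) = ∑ b, lam κ a b f • basisForm κ {b} := by
  have h : ∀ c, twist (lam κ) c (basisForm κ ∅) = basisForm κ {c} := fun c => by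
    funext A
    simp only [twist_apply, basisForm_apply]
    by_cases hA : A = {c}
    · rw [hA, Finset.sum_singleton, sgn_singleton, one_smul, if_pos rfl,
        if_pos (eq_singleton_iff_erase.1 rfl).2, lam_one, if_pos rfl]
    · rw [if_neg hA]
      refine Finset.sum_eq_zero fun b hb => ?_
      split_ifs with h
      · rw [lam_one, if_neg, smul_zero]
        rintro rfl
        exact hA (eq_singleton_iff_erase.2 ⟨hb, h⟩)
      · rw [map_zero, smul_zero]
  rw [ofFun_eq_smul, twist_smul]
  simp only [h]

theorem dagger_ofFun (f : KMink κ) : dagger (ofFun f) = ofFun (star f) := by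
  rw [dagger, ofRightCoeff, Finset.sum_eq_single ∅]
  · rw [wedge_basisForm, twistList, sort_eq_of_pairwise (l := []) (by simp)]
    simp [ofFun]
  · intro A _ hA
    rw [ofFun, if_neg hA, star_zero, smul_zero, wedge_basisForm, ofFun_zero, twistList_zero]
  · simp

/-- Hermitian conjugation commutes with the exterior derivative of functions. -/
theorem dagger_extD_ofFun (hκ : κ ≠ 0) (f : KMink κ) :
    dagger (extD (ofFun f)) = extD (ofFun (star f)) := by
  have h0 : ∀ A : Finset (Fin 5), (∑ a, xi κ a f • basisForm κ {a}) A
      = ∑ a, if A = {a} then xi κ a f else 0 := fun A => by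
    simp [Finset.sum_apply, basisForm_apply]
  have h1 : ∀ A : Finset (Fin 5), wedge (basisForm κ A)
      (ofFun (((-1 : ℂ) ^ (A.card * (A.card - 1) / 2)) • star (extD (ofFun f) A)))
      = ∑ a, if A = {a} then twist (lam κ) a (ofFun (chi κ a (star f))) else 0 := fun A => by
    rw [extD_ofFun, h0]
    by_cases hA : ∃ b, A = {b}
    · obtain ⟨b, rfl⟩ := hA
      simp [wedge_basisForm_singleton, star_xi hκ]
    · push Not at hA
      simp [hA, ofFun_zero, wedge_basisForm, twistList_zero]
  rw [dagger, ofRightCoeff]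
  simp only [h1]
  rw [Finset.sum_comm]
  simp only [Finset.sum_ite_eq', Finset.mem_univ, if_true, twist_ofFun]
  rw [Finset.sum_comm, extD_ofFun]
  simp only [← Finset.sum_smul, sum_lam_chi hκ]

theorem lagrangian_eq (hκ : κ ≠ 0) (m : ℝ) (φ : KMink κ) :
    lagrangian m φ = density m φ • vol κ := by
  have h1 : wedge (extD (ofFun (star φ))) (hodge (extD (ofFun φ)))
      = (∑ a, eta a a • (xi κ a (star φ) * chi κ a φ)) • vol κ := by
    have h2 : ∀ a, twist (lam κ) a (∑ b, xi κ b φ • coBasis κ b)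
        = (eta a a • chi κ a φ) • vol κ := fun a => by
      rw [twist_sum, ← sum_eta_smul_lam_xi hκ, Finset.sum_smul]
      refine Finset.sum_congr rfl fun b _ => ?_
      rw [twist_smul]
      simp only [twist_coBasis, smul_ite, smul_zero, Finset.sum_ite_eq', Finset.mem_univ, if_true,
        smul_complex_smul]
    rw [hodge_extD_ofFun, extD_ofFun, wedge_sum_left, Finset.sum_smul]
    refine Finset.sum_congr rfl fun a _ => ?_
    rw [wedge_smul_left, wedge_basisForm_singleton, h2, smul_smul, mul_smul_comm]
  rw [lagrangian, dagger_extD_ofFun hκ, h1, dagger_ofFun, wedge_ofFun, hodge_ofFun, density_eq,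
    smul_smul, complex_smul_smul, ← add_smul, complex_smul_smul]

/-! ### The currents -/

/-- A function moved past `*eᶜ` from the left to the right. -/
theorem smul_wedge_coBasis (c : Fin 5) (f g : KMink κ) :
    f • wedge (coBasis κ c) (ofFun g)
      = ∑ d, wedge (coBasis κ d) (ofFun (sig κ c d f * g)) := by
  have h : ∀ e k, ∑ d, lam κ d k (sig κ c d f) * lam κ k e g
      = if c = k then f * lam κ k e g else 0 := fun e k => by
    simp only [← Finset.sum_mul, ← sig_lam_comm, sum_sig_lam_apply]
    split_ifs <;> simp
  simp only [wedge_coBasis_ofFun, Finset.smul_sum, smul_smul]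
  rw [Finset.sum_comm]
  refine Finset.sum_congr rfl fun e _ => ?_
  rw [← Finset.sum_smul]
  congr 1
  simp only [lam_mul]
  rw [Finset.sum_comm, Finset.sum_congr rfl fun k _ => h e k]
  simp

theorem wedge_coBasis_one (b : Fin 5) : wedge (coBasis κ b) (ofFun 1) = coBasis κ b := by
  rw [wedge_coBasis_ofFun, Finset.sum_eq_single b (fun c _ h => by
    rw [lam_one, if_neg h.symm, zero_smul]) (by simp), lam_one, if_pos rfl, one_smul]

theorem wedge_coBasis_ofFun_add (b : Fin 5) (f g : KMink κ) :
    wedge (coBasis κ b) (ofFun (f + g))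
      = wedge (coBasis κ b) (ofFun f) + wedge (coBasis κ b) (ofFun g) := by
  simp only [wedge_coBasis_ofFun, map_add, add_smul, Finset.sum_add_distrib]

theorem wedge_coBasis_ofFun_smul (b : Fin 5) (c : ℂ) (f : KMink κ) :
    wedge (coBasis κ b) (ofFun (c • f)) = c • wedge (coBasis κ b) (ofFun f) := by
  simp only [wedge_coBasis_ofFun, map_smul, Finset.smul_sum, complex_smul_smul]

theorem wedge_coBasis_ofFun_sum {ι : Type*} (s : Finset ι) (b : Fin 5) (f : ι → KMink κ) :
    wedge (coBasis κ b) (ofFun (∑ i ∈ s, f i)) = ∑ i ∈ s, wedge (coBasis κ b) (ofFun (f i)) := by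
  simp only [wedge_coBasis_ofFun, map_sum, Finset.sum_smul]
  rw [Finset.sum_comm]

/-- `i_a (f vol) = η_{ab} *eᵇ f`, since `vol` is central. -/
theorem inner_smul_vol (a : Fin 5) (f : KMink κ) :
    inner a (f • vol κ) = eta a a • wedge (coBasis κ a) (ofFun f) := by
  have h1 : rightCoeff (f • vol κ) = f • vol κ := by
    rw [rightCoeff, Finset.sum_eq_single Finset.univ]
    · rw [smul_vol_apply, if_pos rfl, twistList_sig_univ]
    · intro A _ hA
      rw [smul_vol_apply, if_neg hA, ofFun_zero, twistList_zero]
    · simp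
  have h2 : basisForm κ (Finset.univ.erase a)
      = (eta a a * sgn a Finset.univ) • coBasis κ a := by
    rw [coBasis_eq, smul_smul, mul_mul_mul_comm, eta_self_mul_self, sgn_mul_self, one_mul, one_smul]
  rw [inner, ofRightCoeff, h1, Finset.sum_eq_single (Finset.univ.erase a)]
  · rw [if_neg (by simp), Finset.insert_erase (Finset.mem_univ a), smul_vol_apply, if_pos rfl,
      sgn_erase_self, h2, wedge_smul_complex_left, wedge_coBasis_ofFun_smul, smul_smul, mul_assoc,
      sgn_mul_self, mul_one]
  · intro A _ hA
    split_ifs with ha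
    · rw [ofFun_zero, wedge_basisForm, twistList_zero]
    · rw [smul_vol_apply, if_neg, smul_zero, ofFun_zero, wedge_basisForm, twistList_zero]
      intro h
      exact hA (by rw [← h, Finset.erase_insert ha])
  · simp

/-- The coefficients `T_ab` are obtained by moving all functions to the right of `*eᵇ`. -/
theorem current_eq (hκ : κ ≠ 0) (m : ℝ) (φ : KMink κ) (a : Fin 5) :
    current m φ a = ∑ b, wedge (coBasis κ b) (ofFun (energyMomentum m φ a b)) := by
  have h1 : wedge (ofFun (chi κ a (star φ))) (hodge (extD (ofFun φ)))
      = ∑ b, wedge (coBasis κ b) (ofFun (∑ c, sig κ c b (chi κ a (star φ)) * chi κ c φ)) := by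
    have h : ∀ (u v : KMink κ) (c : Fin 5), u • v • coBasis κ c
        = ∑ b, ∑ d, wedge (coBasis κ b) (ofFun (sig κ d b u * sig κ c d v)) := fun u v c => by
      rw [smul_smul, ← wedge_coBasis_one c, smul_wedge_coBasis]
      simp only [mul_one, sig_mul, wedge_coBasis_ofFun_sum]
    rw [wedge_ofFun, hodge_extD_ofFun, Finset.smul_sum]
    simp only [h]
    rw [Finset.sum_comm]
    refine Finset.sum_congr rfl fun b _ => ?_
    rw [Finset.sum_comm, wedge_coBasis_ofFun_sum]
    refine Finset.sum_congr rfl fun d _ => ?_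
    rw [← wedge_coBasis_ofFun_sum, ← Finset.mul_sum, sum_sig_xi hκ]
  have h2 : ∑ b, wedge (hodge (extD (ofFun (sig κ b a (star φ))))) (ofFun (chi κ b φ))
      = ∑ b, wedge (coBasis κ b) (ofFun (∑ c, sig κ c a (chi κ b (star φ)) * chi κ c φ)) := by
    have h : ∀ u v : KMink κ, wedge (hodge (extD (ofFun u))) (ofFun v)
        = ∑ d, wedge (coBasis κ d) (ofFun (chi κ d u * v)) := fun u v => by
      rw [hodge_extD_ofFun, wedge_sum_left]
      simp only [wedge_smul_left, smul_wedge_coBasis]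
      rw [Finset.sum_comm]
      simp only [← wedge_coBasis_ofFun_sum, ← Finset.sum_mul, sum_sig_xi hκ]
    simp only [h, wedge_coBasis_ofFun_sum]
    rw [Finset.sum_comm]
    refine Finset.sum_congr rfl fun d _ => Finset.sum_congr rfl fun b _ => ?_
    rw [show chi κ d (sig κ b a (star φ)) = sig κ b a (chi κ d (star φ)) from
      (LinearMap.congr_fun (commute_sig_chi hκ b a d) _).symm]
  have h3 : inner a (lagrangian m φ)
      = ∑ b, wedge (coBasis κ b) (ofFun (eta a b • density m φ)) := by
    rw [lagrangian_eq hκ, inner_smul_vol, Finset.sum_eq_single a, wedge_coBasis_ofFun_smul]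
    · intro b _ hb
      rw [eta_of_ne hb.symm, wedge_coBasis_ofFun_smul, zero_smul]
    · simp
  rw [current, h1, h2, h3, ← Finset.sum_add_distrib, Finset.smul_sum, ← Finset.sum_sub_distrib]
  refine Finset.sum_congr rfl fun b _ => ?_
  rw [energyMomentum, sub_eq_add_neg (_ • _) (_ • density m φ), ← neg_smul,
    wedge_coBasis_ofFun_add, wedge_coBasis_ofFun_smul b (eta a b),
    wedge_coBasis_ofFun_smul b (1 / 2), wedge_coBasis_ofFun_add, wedge_coBasis_ofFun_smul b (-_),
    neg_smul, sub_eq_add_neg]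

theorem sum_wedge_coBasis_eq (T : Fin 5 → KMink κ) :
    ∑ b, wedge (coBasis κ b) (ofFun (T b)) = ∑ c, (∑ b, lam κ b c (T b)) • coBasis κ c := by
  simp only [wedge_coBasis_ofFun, Finset.sum_smul]
  rw [Finset.sum_comm]

/-- `d (*eᵇ T_b) = η^{ab} (χ_a ▷ T_b) vol`. -/
theorem extD_sum_wedge_coBasis (hκ : κ ≠ 0) (T : Fin 5 → KMink κ) :
    extD (∑ b, wedge (coBasis κ b) (ofFun (T b))) = (∑ b, eta b b • chi κ b (T b)) • vol κ := by
  rw [sum_wedge_coBasis_eq, extD_sum_smul_coBasis]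
  congr 1
  simp only [map_sum, Finset.smul_sum]
  rw [Finset.sum_comm]
  refine Finset.sum_congr rfl fun b _ => ?_
  rw [← sum_eta_smul_lam_xi hκ]
  refine Finset.sum_congr rfl fun c _ => ?_
  congr 1
  exact (LinearMap.congr_fun (commute_lam_xi hκ b c c) _).symm

theorem phaseCurrent_eq (φ : KMink κ) :
    phaseCurrent φ = ∑ a, (star φ * xi κ a φ - ∑ b, xi κ b (star φ) * lam κ b a φ) •
      coBasis κ a := by
  have h : wedge (ofFun (star φ)) (extD (ofFun φ)) - wedge (extD (ofFun (star φ))) (ofFun φ)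
      = ∑ a, (star φ * xi κ a φ - ∑ b, xi κ b (star φ) * lam κ b a φ) • basisForm κ {a} := by
    rw [wedge_ofFun, extD_ofFun, extD_ofFun, wedge_sum_left]
    simp only [wedge_smul_left, wedge_basisForm_singleton, twist_ofFun, Finset.smul_sum, smul_smul,
      sub_smul, Finset.sum_smul, Finset.sum_sub_distrib]
    rw [Finset.sum_comm (γ := Fin 5)]
  rw [phaseCurrent, h, hodge_sum]
  simp only [hodge_smul, coBasis]

theorem box_eq_of_equationOfMotion {m : ℝ} {φ : KMink κ} (h : EquationOfMotion m φ) :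
    box φ = ((m : ℂ) ^ 2) • φ := by
  rw [EquationOfMotion, hodge_extD_ofFun, extD_sum_smul_coBasis, hodge_smul] at h
  have h' := congrFun h ∅
  rw [form_smul_apply, hodge_vol_empty, mul_one] at h'
  exact h'

end KappaMinkowski

theorem mainTheorem1 (κ : ℝ) (hκ : κ ≠ 0) (m : ℝ) (φ : KappaMinkowski.KMink κ) :
    -- The Lagrangian is the density times the volume form; the `T_ab` are the components of `j_a`.
    (KappaMinkowski.lagrangian m φ = KappaMinkowski.density m φ • KappaMinkowski.vol κ) ∧
    (∀ a, KappaMinkowski.current m φ a ∈ KappaMinkowski.Gamma κ 4) ∧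
    (∀ a, KappaMinkowski.current m φ a =
      ∑ b, KappaMinkowski.wedge (KappaMinkowski.hodge (KappaMinkowski.basisForm κ {b}))
        (KappaMinkowski.ofFun (KappaMinkowski.energyMomentum m φ a b))) ∧
    (KappaMinkowski.phaseCurrent φ ∈ KappaMinkowski.Gamma κ 4) ∧
    -- On-shell, the currents are closed.
    (KappaMinkowski.EquationOfMotion m φ → KappaMinkowski.EquationOfMotion m (star φ) →
      (∀ a, KappaMinkowski.extD (KappaMinkowski.current m φ a) = 0) ∧
      KappaMinkowski.extD (KappaMinkowski.phaseCurrent φ) = 0) := by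

  open KappaMinkowski in
  refine ⟨lagrangian_eq hκ m φ, fun a => ?_, current_eq hκ m φ, ?_, fun h1 h2 => ⟨fun a => ?_, ?_⟩⟩
  · rw [current_eq hκ, sum_wedge_coBasis_eq]
    exact sum_smul_coBasis_mem_Gamma _
  · rw [phaseCurrent_eq]
    exact sum_smul_coBasis_mem_Gamma _
  · rw [current_eq hκ, extD_sum_wedge_coBasis hκ, divergence_energyMomentum hκ m φ
      (box_eq_of_equationOfMotion h1) (box_eq_of_equationOfMotion h2), zero_smul]
  · rw [phaseCurrent_eq, extD_sum_smul_coBasis, divergence_phase hκ _ _ _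
      (box_eq_of_equationOfMotion h1) (box_eq_of_equationOfMotion h2), zero_smul]
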